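/- **Setting.** Let $\Gamma$ be a finite simple graph with vertex set $X$, and let $G$ be the right-angled Artin group with generators $X$ and relations $xy=yx$ for every edge $x-y$ of $\Gamma$. Words are words over the alphabet $X\cup X^{-1}$; a word is positive if it lies in $X^{*}$ (the empty word is positive). Fix a total ordering $<$ of $X\cup X^{-1}$ that orients the four relations of each edge in the same way: for an edge $x-y$, if $y^{\varepsilon}<x^{\gamma}$ for some signs $\gamma,\varepsilon\in\{1,-1\}$, then for all signs. Order words by the induced length-lexicographical ordering. Put $$\Re_0=\{x^{\gamma}y^{\varepsilon}\to y^{\varepsilon}x^{\gamma} : x-y \text{ an edge},\ \gamma,\varepsilon=\pm1,\ y^{\varepsilon}<x^{\gamma}\},\qquad F=\{xx^{-1}\to1,\ x^{-1}x\to 1 : x\in X\}.$$ An overlap of a rule $uv\to r_1$ at left with a rule $vw\to r_2$ at right ($u,v,w$ non-empty) has the overlapped word $uvw$ and the critical pair $(r_1w,\,ur_2)$; it resolves modulo a system $S$ if these two words have a common descendant under $\to_S^{*}$. **Completion.** Start with $S_0=\Re_0\cup F$. At step $n\ge1$ treat, among all overlaps between rules of $S_{n-1}$ not treated at an earlier step,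 all those whose overlapped word is shortest. For each of them, reduce both words of the critical pair to a normal form modulo $S_{n-1}$ (an arbitrary one, if there are several; normal forms are selected by a fixed choice depending only on the system and the word). If the two normal forms differ, the overlap produces the rule from the greater to the smaller one. Let $S_n$ be $S_{n-1}$ together with the rules produced at step $n$, and let $\Re=\bigl(\bigcup_n S_n\bigr)\setminus F$. A rule $ux\to xu$, with $u=t_1t_2\cdots t_k$, $k\ge1$ and $x,t_i\in X\cup X^{-1}$, satisfies the condition on prefixes if $t_1x\to xt_1$ and $xt_i\to t_ix$ ($2\le i\le k$) are rules of $\Re_0$. A system satisfies $C^{+}$ if it has at least one rule with positive left-hand side and every rule with positive left-hand side has a positive right-hand side. **Proposition.** For every such choice of normal forms the following hold. (i) The system $\Re\cup F$ is complete (terminating and confluent) and equivalent to $\Re_0\cup F$; two words are equivalent modulo $\Re\cup F$ if and only if they represent the same element of $G$. Moreover: * (A) Every rule of $\Re$ has the form $ux\to xu$ and satisfies the condition on prefixes. * (B) Every overlap between rules of $\Re\cup F$ is treated at some step. If an overlap treated at step $n$ produces a rule, then its left rule is in $\Re$ and its right rule is in $\Re_0$; every overlap treated at step $n$ that is not of this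 kind (left rule in $\Re$, right rule in $\Re_0$) resolves modulo $S_{n-1}$. * (C) Both sides of every rule of $\Re_0$ have length $2$, and both sides of every rule produced at step $n\ge1$ have length $n+2$. (ii) For every rule of $\Re$, one side is a positive word if and only if the other side is. In particular, if $\Gamma$ has at least one edge, then $\Re$ and $\Re\cup F$ satisfy $C^{+}$ (even if $\Re$ is infinite). -/

import Mathlib

namespace KnuthBendix

/-! ### String rewriting systems -/

/-- A rewriting rule `l → r` over the alphabet `α`, stored as the pair `(l, r)`; words over `α`
are lists, the empty list being the empty word. -/
abbrev Rule (α : Type*) := List α × List α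

/-- One reduction step `p l q → p r q`, for a rule `l → r` of `S`. -/
def Reduces {α : Type*} (S : Set (Rule α)) (a b : List α) : Prop :=
  ∃ p q : List α, ∃ ρ ∈ S, a = p ++ ρ.1 ++ q ∧ b = p ++ ρ.2 ++ q

/-- The reflexive transitive closure `→*` of the reduction relation. -/
def ReducesStar {α : Type*} (S : Set (Rule α)) : List α → List α → Prop :=
  Relation.ReflTransGen (Reduces S)

/-- The equivalence `↔*` generated by the reduction relation. -/
def Equivalent {α : Type*} (S : Set (Rule α)) : List α → List α → Prop :=
  Relation.EqvGen (Reduces S)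

def Irreducible {α : Type*} (S : Set (Rule α)) (w : List α) : Prop :=
  ¬ ∃ z, Reduces S w z

/-- There is no infinite sequence of reductions. -/
def Terminating {α : Type*} (S : Set (Rule α)) : Prop :=
  ¬ ∃ f : ℕ → List α, ∀ n, Reduces S (f n) (f (n + 1))

/-- The words `a` and `b` have a common descendant. -/
def Joinable {α : Type*} (S : Set (Rule α)) (a b : List α) : Prop :=
  ∃ z, ReducesStar S a z ∧ ReducesStar S b z

def Confluent {α : Type*} (S : Set (Rule α)) : Prop :=
  ∀ w a b, ReducesStar S w a → ReducesStar S w b → Joinable S a b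

def Complete {α : Type*} (S : Set (Rule α)) : Prop :=
  Terminating S ∧ Confluent S

/-! ### Overlap ambiguities -/

/-- The data of an overlap of a rule `uv → r₁` at left with a rule `vw → r₂` at right. -/
structure Overlap (α : Type*) where
  u : List α
  v : List α
  w : List α
  r₁ : List α
  r₂ : List α

/-- The rule `uv → r₁` at left. -/
def Overlap.left {α : Type*} (o : Overlap α) : Rule α := (o.u ++ o.v, o.r₁)

/-- The rule `vw → r₂` at right. -/
def Overlap.right {α : Type*} (o : Overlap α) : Rule α := (o.v ++ o.w, o.r₂)

/-- The length of the overlapped word `uvw`. -/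
def Overlap.length {α : Type*} (o : Overlap α) : ℕ := (o.u ++ o.v ++ o.w).length

/-- The first word `r₁w` of the critical pair. -/
def Overlap.crit₁ {α : Type*} (o : Overlap α) : List α := o.r₁ ++ o.w

/-- The second word `ur₂` of the critical pair. -/
def Overlap.crit₂ {α : Type*} (o : Overlap α) : List α := o.u ++ o.r₂

/-- `o` is an overlap ambiguity of the system `S`. -/
def Overlap.IsIn {α : Type*} (o : Overlap α) (S : Set (Rule α)) : Prop :=
  o.u ≠ [] ∧ o.v ≠ [] ∧ o.w ≠ [] ∧ o.left ∈ S ∧ o.right ∈ S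

/-- The critical pair of the overlap `o` resolves by means of `S`. -/
def Overlap.Resolves {α : Type*} (o : Overlap α) (S : Set (Rule α)) : Prop :=
  Joinable S o.crit₁ o.crit₂

/-! ### The completion procedure -/

/-- `nf S w` is a normal form of `w` modulo `S`, for every system `S` all of whose rules decrease
strictly in the length-lexicographical ordering induced by `lt`. Such a system need not be
confluent, so a word may have several normal forms; `nf` selects one of them. -/
def IsNormalizer {α : Type*} (lt : α → α → Prop)
    (nf : Set (Rule α) → List α → List α) : Prop :=
  ∀ S : Set (Rule α), (∀ ρ ∈ S, List.Shortlex lt ρ.2 ρ.1) →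
    ∀ w, ReducesStar S w (nf S w) ∧ Irreducible S (nf S w)

/-- A state of the procedure: the rules obtained so far and the overlaps already treated. -/
structure State (α : Type*) where
  rules : Set (Rule α)
  treated : Set (Overlap α)

/-- The overlaps between the present rules that have not been treated yet. -/
def State.pending {α : Type*} (s : State α) : Set (Overlap α) :=
  {o | o.IsIn s.rules ∧ o ∉ s.treated}

/-- The overlaps to be treated next: all pending ones whose overlapped word is shortest. -/
def State.next {α : Type*} (s : State α) : Set (Overlap α) :=
  {o | o ∈ s.pending ∧ ∀ o' ∈ s.pending, o.length ≤ o'.length}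

/-- The overlap `o` produces the rule `ρ` over `S`: the normal forms modulo `S` of the two words
of its critical pair are different, and `ρ` rewrites the greater one to the smaller one. -/
def Produces {α : Type*} (lt : α → α → Prop) (nf : Set (Rule α) → List α → List α)
    (S : Set (Rule α)) (o : Overlap α) (ρ : Rule α) : Prop :=
  List.Shortlex lt ρ.2 ρ.1 ∧
    (ρ = (nf S o.crit₁, nf S o.crit₂) ∨ ρ = (nf S o.crit₂, nf S o.crit₁))

/-- The rules produced by the overlaps to be treated next. -/
def State.newRules {α : Type*} (lt : α → α → Prop) (nf : Set (Rule α) → List α → List α)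
    (s : State α) : Set (Rule α) :=
  {ρ | ∃ o ∈ s.next, Produces lt nf s.rules o ρ}

/-- One step of the completion. -/
def State.step {α : Type*} (lt : α → α → Prop) (nf : Set (Rule α) → List α → List α)
    (s : State α) : State α where
  rules := s.rules ∪ s.newRules lt nf
  treated := s.treated ∪ s.next

/-- The state after `n` steps of the completion of the system `S₀`. -/
def run {α : Type*} (lt : α → α → Prop) (nf : Set (Rule α) → List α → List α)
    (S₀ : Set (Rule α)) : ℕ → State α
  | 0 => ⟨S₀, ∅⟩
  | n + 1 => (run lt nf S₀ n).step lt nf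

/-- The (possibly infinite) system obtained by the completion of `S₀`. -/
def completion {α : Type*} (lt : α → α → Prop) (nf : Set (Rule α) → List α → List α)
    (S₀ : Set (Rule α)) : Set (Rule α) :=
  ⋃ n, (run lt nf S₀ n).rules

end KnuthBendix

namespace RightAngledArtin

open KnuthBendix

/-! ### Right-angled Artin groups

The letter `(x, true)` stands for the generator `x` and `(x, false)` for its inverse. -/

/-- The right-angled Artin group with defining graph `Γ`. -/
abbrev Grp {V : Type*} (Γ : SimpleGraph V) :=
  PresentedGroup {c : FreeGroup V | ∃ x y, Γ.Adj x y ∧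
    c = FreeGroup.of x * FreeGroup.of y * (FreeGroup.of x)⁻¹ * (FreeGroup.of y)⁻¹}

/-- The element of the right-angled Artin group represented by a word. -/
def value {V : Type*} (Γ : SimpleGraph V) (w : List (V × Bool)) : Grp Γ :=
  PresentedGroup.mk _ (FreeGroup.mk w)

/-- The rules of free reduction `x x⁻¹ → 1` and `x⁻¹ x → 1`. -/
def freeRules (V : Type*) : Set (Rule (V × Bool)) :=
  {ρ | ∃ (x : V) (γ : Bool), ρ = ([(x, γ), (x, !γ)], [])}

/-- The commutation rules `x^γ y^ε → y^ε x^γ`, for all edges `x - y` and all signs such that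
`y^ε < x^γ`. -/
def commRules {V : Type*} (Γ : SimpleGraph V) (lt : V × Bool → V × Bool → Prop) :
    Set (Rule (V × Bool)) :=
  {ρ | ∃ (x y : V) (γ ε : Bool), Γ.Adj x y ∧ lt (y, ε) (x, γ) ∧
    ρ = ([(x, γ), (y, ε)], [(y, ε), (x, γ)])}

/-- The ordering of the letters orients the four relations that belong to an edge in the same
way, whatever the signs. -/
def OrientsEdges {V : Type*} (Γ : SimpleGraph V) (lt : V × Bool → V × Bool → Prop) : Prop :=
  ∀ (x y : V) (γ ε γ' ε' : Bool), Γ.Adj x y → lt (y, ε) (x, γ) → lt (y, ε') (x, γ')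

/-- The rule `u x → x u` satisfies the condition on prefixes with respect to `R₀`. -/
def PrefixCondition {α : Type*} (R₀ : Set (Rule α)) (u : List α) (x : α) : Prop :=
  ∃ (t : α) (ts : List α), u = t :: ts ∧ ([t, x], [x, t]) ∈ R₀ ∧
    ∀ s ∈ ts, ([x, s], [s, x]) ∈ R₀

/-- A positive word, that is a word in the generators; the empty word is positive. -/
def Positive {V : Type*} (w : List (V × Bool)) : Prop :=
  ∀ a ∈ w, a.2 = true

/-- The rules of `S` with positive left-hand side. -/
def positivePart {V : Type*} (S : Set (Rule (V × Bool))) : Set (Rule (V × Bool)) :=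
  {ρ | ρ ∈ S ∧ Positive ρ.1}

/-- The condition `C⁺`, for a system with at least one rule with positive left-hand side. -/
def ConditionCPlus {V : Type*} (S : Set (Rule (V × Bool))) : Prop :=
  (positivePart S).Nonempty ∧ ∀ ρ ∈ S, Positive ρ.1 → Positive ρ.2

end RightAngledArtin

/-! ### Normal words and the action of the group on them -/

namespace RightAngledArtin

open KnuthBendix

section NormalWords

variable {V : Type*} (Γ : SimpleGraph V) (lt : V × Bool → V × Bool → Prop)

/-! The limit system can be written down in advance. Call a word normal if no letter can be commuted
back to cancel an earlier letter, or past a greater commuting one. The expected rules are `u x → x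
u` with the condition on prefixes and with `u` normal (`normalRules`).

These rules together with `F` are complete because their irreducible words are exactly the normal
words. A non-normal word contains a left-hand side (`exists_factor_of_not_normalWord`), and each
group element has at most one normal word. Uniqueness is van der Waerden's argument: inserting a
letter permutes the normal words, insertions of adjacent letters commute, so `G` acts on normal
words, and a normal word is recovered by letting its value act on the empty word
(`NormalWord.eq_of_value_eq`). Termination is well-foundedness of shortlex on a finite alphabet.

By induction, the completion after `n` steps has exactly `F` and the normal rules of length at most
`n + 2` (`RunInvariant`). A word of length at most `n + 3` irreducible for these is either normal or
itself a normal left-hand side. So two distinct normal forms of one critical pair form a normal rule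
of length `n + 3`, whatever choice is made (`mem_normalRules_of_shortlex`). Conversely, the rule for
`t us y x` arises by overlapping the shorter rule for `t us x` with `xy → yx`
(`exists_overlap_produces`). If no normal rule of length `n + 3` exists, then no longer one does
either, since rules can be truncated; the system is then complete and nothing more is produced.

For (B), comparing lengths excludes free rules from a productive overlap, and comparing letters
forces the right rule to have length 2 (`mem_of_produces`). Normal rules only permute letters, which
gives the length and positivity claims. -/

/-- The inverse of a letter. -/
def letterInv (a : V × Bool) : V × Bool := (a.1, !a.2)

@[simp]
theorem letterInv_letterInv (a : V × Bool) : letterInv (letterInv a) = a := by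
  simp [letterInv]

/-- All letters of the word `w` are adjacent to the letter `a`. -/
def AllAdj (a : V × Bool) (w : List (V × Bool)) : Prop := ∀ c ∈ w, Γ.Adj c.1 a.1

/-- The letter `a` can be moved to the front of the word by commutations. -/
def Front (a : V × Bool) : List (V × Bool) → Prop
  | [] => False
  | c :: w => a = c ∨ (Γ.Adj a.1 c.1 ∧ Front a w)

/-- A word is normal if no letter can be moved by commutations next to an earlier letter which it
cancels, or in front of a greater commuting letter. -/
def NormalWord : List (V × Bool) → Prop
  | [] => True
  | c :: w => (∀ a, Front Γ a w → a ≠ letterInv c ∧ (Γ.Adj a.1 c.1 → lt c a)) ∧ NormalWord w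

open Classical in
/-- Right multiplication of a normal word by a letter. -/
noncomputable def insertLetter (a : V × Bool) : List (V × Bool) → List (V × Bool)
  | [] => [a]
  | c :: w =>
    if AllAdj Γ a w ∧ c = letterInv a then w
    else if AllAdj Γ a (c :: w) ∧ lt a c then a :: c :: w
    else c :: insertLetter a w

variable {Γ lt}

theorem allAdj_nil (a : V × Bool) : AllAdj Γ a [] := by simp [AllAdj]

theorem allAdj_cons {a c : V × Bool} {w : List (V × Bool)} :
    AllAdj Γ a (c :: w) ↔ Γ.Adj c.1 a.1 ∧ AllAdj Γ a w := by simp [AllAdj]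

theorem Front.mem {a : V × Bool} : ∀ {w : List (V × Bool)}, Front Γ a w → a ∈ w
  | [], h => h.elim
  | c :: w, h => by
    rcases h with h | h
    · simp [h]
    · exact List.mem_cons_of_mem _ h.2.mem

theorem Front.append_right {a : V × Bool} (v : List (V × Bool)) :
    ∀ {w : List (V × Bool)}, Front Γ a w → Front Γ a (w ++ v)
  | [], h => h.elim
  | c :: w, h => by
    rcases h with h | h
    · exact Or.inl h
    · exact Or.inr ⟨h.1, h.2.append_right v⟩

theorem AllAdj.front_append {a : V × Bool} {v : List (V × Bool)} (hv : Front Γ a v) :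
    ∀ {w : List (V × Bool)}, AllAdj Γ a w → Front Γ a (w ++ v)
  | [], _ => hv
  | c :: w, h => by
    rw [allAdj_cons] at h
    exact Or.inr ⟨h.1.symm, h.2.front_append hv⟩

theorem front_singleton (a : V × Bool) : Front Γ a [a] := Or.inl rfl

theorem front_cons_self (a : V × Bool) (w : List (V × Bool)) : Front Γ a (a :: w) := Or.inl rfl

theorem Front.exists_append {a : V × Bool} : ∀ {w : List (V × Bool)}, Front Γ a w →
    ∃ u v, w = u ++ a :: v ∧ AllAdj Γ a u
  | [], h => h.elim
  | c :: w, h => by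
    rcases h with rfl | h
    · exact ⟨[], w, rfl, allAdj_nil _⟩
    · obtain ⟨u, v, rfl, hu⟩ := h.2.exists_append
      exact ⟨c :: u, v, rfl, allAdj_cons.2 ⟨h.1.symm, hu⟩⟩

theorem AllAdj.ne_letterInv_of_mem {a b : V × Bool} {w : List (V × Bool)} (h : AllAdj Γ a w)
    (hb : b ∈ w) : b ≠ letterInv a := by
  rintro rfl
  exact Γ.irrefl (v := a.1) (h (letterInv a) hb)

theorem NormalWord.of_append_right : ∀ {p q : List (V × Bool)}, NormalWord Γ lt (p ++ q) →
    NormalWord Γ lt q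
  | [], _, h => h
  | _ :: _, _, h => NormalWord.of_append_right h.2

theorem NormalWord.of_append_left : ∀ {p q : List (V × Bool)}, NormalWord Γ lt (p ++ q) →
    NormalWord Γ lt p
  | [], _, _ => trivial
  | _ :: _, q, h => ⟨fun a ha => h.1 a (ha.append_right q), NormalWord.of_append_left h.2⟩

theorem normalWord_singleton (a : V × Bool) : NormalWord Γ lt [a] :=
  ⟨fun _ h => h.elim, trivial⟩

theorem insertLetter_of_cancel {a c : V × Bool} {w : List (V × Bool)} (h : AllAdj Γ a w)
    (hc : c = letterInv a) : insertLetter Γ lt a (c :: w) = w := by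
  rw [insertLetter, if_pos ⟨h, hc⟩]

theorem insertLetter_of_lt {a c : V × Bool} {w : List (V × Bool)} (h : AllAdj Γ a (c :: w))
    (hc : lt a c) : insertLetter Γ lt a (c :: w) = a :: c :: w := by
  rw [insertLetter, if_neg, if_pos ⟨h, hc⟩]
  exact fun h' => h.ne_letterInv_of_mem (by simp) h'.2

theorem insertLetter_of_not {a c : V × Bool} {w : List (V × Bool)}
    (h₁ : ¬ (AllAdj Γ a w ∧ c = letterInv a)) (h₂ : ¬ (AllAdj Γ a (c :: w) ∧ lt a c)) :
    insertLetter Γ lt a (c :: w) = c :: insertLetter Γ lt a w := by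
  rw [insertLetter, if_neg h₁, if_neg h₂]

theorem insertLetter_cases (Γ : SimpleGraph V) (lt : V × Bool → V × Bool → Prop) (a c : V × Bool)
    (w : List (V × Bool)) :
    (AllAdj Γ a w ∧ c = letterInv a) ∨ (AllAdj Γ a (c :: w) ∧ lt a c) ∨
      (¬ (AllAdj Γ a w ∧ c = letterInv a) ∧ ¬ (AllAdj Γ a (c :: w) ∧ lt a c)) := by
  tauto

/-- Insertion exposes no old letter that was hidden: a cancelled letter commutes with everything
after it, so it was not blocking anything. This is what keeps inserted words normal. -/
theorem front_insertLetter {a b : V × Bool} : ∀ {w : List (V × Bool)},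
    Front Γ b (insertLetter Γ lt a w) → Front Γ b w ∨ (b = a ∧ AllAdj Γ a w)
  | [], h => by
    rcases h with h | h
    · exact Or.inr ⟨h, allAdj_nil _⟩
    · exact h.2.elim
  | c :: w, h => by
    rcases insertLetter_cases Γ lt a c w with ⟨h₁, rfl⟩ | ⟨h₁, h₂⟩ | ⟨h₁, h₂⟩
    · rw [insertLetter_of_cancel h₁ rfl] at h
      exact Or.inl (Or.inr ⟨h₁ _ h.mem, h⟩)
    · rw [insertLetter_of_lt h₁ h₂] at h
      rcases h with h | h
      · exact Or.inr ⟨h, h₁⟩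
      · exact Or.inl h.2
    · rw [insertLetter_of_not h₁ h₂] at h
      rcases h with h | ⟨h, h'⟩
      · exact Or.inl (Or.inl h)
      · rcases front_insertLetter h' with h' | ⟨rfl, h'⟩
        · exact Or.inl (Or.inr ⟨h, h'⟩)
        · exact Or.inr ⟨rfl, allAdj_cons.2 ⟨h.symm, h'⟩⟩

theorem allAdj_insertLetter_iff {a b : V × Bool} (hab : Γ.Adj a.1 b.1) :
    ∀ {w : List (V × Bool)}, AllAdj Γ b (insertLetter Γ lt a w) ↔ AllAdj Γ b w
  | [] => by simp [insertLetter, AllAdj, hab]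
  | c :: w => by
    rcases insertLetter_cases Γ lt a c w with ⟨h₁, rfl⟩ | ⟨h₁, h₂⟩ | ⟨h₁, h₂⟩
    · rw [insertLetter_of_cancel h₁ rfl, allAdj_cons]
      exact (and_iff_right hab).symm
    · rw [insertLetter_of_lt h₁ h₂, allAdj_cons (c := a)]
      exact and_iff_right hab
    · rw [insertLetter_of_not h₁ h₂, allAdj_cons, allAdj_cons, allAdj_insertLetter_iff hab]

/-- No letter is adjacent to itself, so `a` cannot occur in the result: it was cancelled, after
passing only letters that commute with it. -/
theorem front_letterInv_of_allAdj_insertLetter {a : V × Bool} : ∀ {w : List (V × Bool)},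
    AllAdj Γ a (insertLetter Γ lt a w) → Front Γ (letterInv a) w
  | [], h => (Γ.irrefl (h a (by simp [insertLetter]))).elim
  | c :: w, h => by
    rcases insertLetter_cases Γ lt a c w with ⟨h₁, rfl⟩ | ⟨h₁, h₂⟩ | ⟨h₁, h₂⟩
    · exact Or.inl rfl
    · rw [insertLetter_of_lt h₁ h₂] at h
      exact (Γ.irrefl (h a (by simp))).elim
    · rw [insertLetter_of_not h₁ h₂, allAdj_cons] at h
      exact Or.inr ⟨h.1.symm, front_letterInv_of_allAdj_insertLetter h.2⟩

theorem insertLetter_eq_cons {a : V × Bool} : ∀ {w : List (V × Bool)}, AllAdj Γ a w →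
    (∀ b, Front Γ b w → lt a b) → insertLetter Γ lt a w = a :: w
  | [], _, _ => rfl
  | c :: w, h, h' => insertLetter_of_lt h (h' c (front_cons_self c w))

variable [IsStrictTotalOrder (V × Bool) lt]

theorem lt_or_lt_of_adj {a b : V × Bool} (h : Γ.Adj a.1 b.1) : lt a b ∨ lt b a := by
  rcases trichotomous_of lt a b with h' | rfl | h'
  · exact Or.inl h'
  · exact (Γ.irrefl h).elim
  · exact Or.inr h'

theorem NormalWord.insertLetter {a : V × Bool} : ∀ {w : List (V × Bool)}, NormalWord Γ lt w →
    NormalWord Γ lt (insertLetter Γ lt a w)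
  | [], _ => normalWord_singleton a
  | c :: w, h => by
    rcases insertLetter_cases Γ lt a c w with ⟨h₁, rfl⟩ | ⟨h₁, h₂⟩ | ⟨h₁, h₂⟩
    · rw [insertLetter_of_cancel h₁ rfl]
      exact h.2
    · rw [insertLetter_of_lt h₁ h₂]
      refine ⟨fun b hb => ⟨h₁.ne_letterInv_of_mem hb.mem, fun _ => ?_⟩, h⟩
      rcases hb with rfl | ⟨hbc, hb⟩
      · exact h₂
      · exact trans_of lt h₂ ((h.1 b hb).2 hbc)
    · rw [insertLetter_of_not h₁ h₂]
      refine ⟨fun b hb => ?_, NormalWord.insertLetter h.2⟩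
      rcases front_insertLetter hb with hb | ⟨rfl, hb⟩
      · exact h.1 b hb
      · refine ⟨fun hbc => h₁ ⟨hb, by simp [hbc]⟩, fun hbc => ?_⟩
        exact (lt_or_lt_of_adj hbc).resolve_left fun hlt =>
          h₂ ⟨allAdj_cons.2 ⟨hbc.symm, hb⟩, hlt⟩

/-- Normality enters twice: a cancelled letter is put back at its old place because it precedes
every commuting letter in front of the remainder, and the second insertion cannot stop too early
because that would expose a forbidden letter behind `c`. -/
theorem insertLetter_letterInv_insertLetter (a : V × Bool) : ∀ {w : List (V × Bool)},
    NormalWord Γ lt w → insertLetter Γ lt (letterInv a) (insertLetter Γ lt a w) = w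
  | [], _ => insertLetter_of_cancel (allAdj_nil _) (by simp)
  | c :: w, h => by
    rcases insertLetter_cases Γ lt a c w with ⟨h₁, rfl⟩ | ⟨h₁, h₂⟩ | ⟨h₁, h₂⟩
    · rw [insertLetter_of_cancel h₁ rfl]
      exact insertLetter_eq_cons h₁ fun b hb => (h.1 b hb).2 (h₁ b hb.mem)
    · rw [insertLetter_of_lt h₁ h₂]
      exact insertLetter_of_cancel h₁ (by simp)
    · rw [insertLetter_of_not h₁ h₂, insertLetter_of_not,
        insertLetter_letterInv_insertLetter a h.2]
      · rintro ⟨h₃, h₄⟩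
        rw [letterInv_letterInv] at h₄
        exact (h.1 _ (front_letterInv_of_allAdj_insertLetter h₃)).1 (by rw [h₄])
      · rintro ⟨h₃, h₄⟩
        rw [allAdj_cons] at h₃
        exact asymm_of lt h₄
          ((h.1 _ (front_letterInv_of_allAdj_insertLetter h₃.2)).2 h₃.1.symm)

/-- Each letter either cancels `c`, stops before `c`, or passes it; adjacency makes these choices
insensitive to the presence of the other letter, apart from the order of `a` and `b`. -/
theorem insertLetter_comm_of_lt (hlt : OrientsEdges Γ lt) {a b : V × Bool} (hab : Γ.Adj a.1 b.1)
    (h : lt a b) : ∀ {w : List (V × Bool)}, NormalWord Γ lt w →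
    insertLetter Γ lt b (insertLetter Γ lt a w) = insertLetter Γ lt a (insertLetter Γ lt b w)
  | [], _ => by
    have h₁ : insertLetter Γ lt a [b] = [a, b] :=
      insertLetter_of_lt (by simpa [AllAdj] using hab.symm) h
    change insertLetter Γ lt b [a] = insertLetter Γ lt a [b]
    rw [h₁, insertLetter_of_not]
    · rfl
    · rintro ⟨-, rfl⟩
      exact Γ.irrefl hab
    · exact fun h' => asymm_of lt h h'.2
  | c :: w, hw => by
    have hba := hab.symm
    have hne : a ≠ letterInv b := by
      rintro rfl
      exact Γ.irrefl hab
    have key : ∀ v, insertLetter Γ lt b (a :: v) = a :: insertLetter Γ lt b v := fun v =>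
      insertLetter_of_not (fun h' => hne h'.2) fun h' => asymm_of lt h h'.2
    rcases insertLetter_cases Γ lt a c w with ⟨h₁, h₂⟩ | ⟨h₁, h₂⟩ | ⟨h₁, h₂⟩ <;>
    rcases insertLetter_cases Γ lt b c w with ⟨h₃, h₄⟩ | ⟨h₃, h₄⟩ | ⟨h₃, h₄⟩
    · rw [h₂] at h₄
      have h₅ : a = b := by rw [← letterInv_letterInv a, h₄, letterInv_letterInv]
      exact (irrefl_of lt b (h₅ ▸ h)).elim
    · subst h₂
      -- Here `b` would precede the inverse of `a` although `a` precedes `b`: this is where uniform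
      -- orientation of signs is needed.
      exact (asymm_of lt h₄ (hlt b.1 a.1 b.2 a.2 b.2 (!a.2) hba h)).elim
    · rw [insertLetter_of_cancel h₁ h₂, insertLetter_of_not h₃ h₄, insertLetter_of_cancel _ h₂]
      exact (allAdj_insertLetter_iff hba).2 h₁
    · rw [insertLetter_of_lt h₁ h₂, insertLetter_of_cancel h₃ h₄, key,
        insertLetter_of_cancel h₃ h₄]
      rw [allAdj_cons] at h₁
      -- With `c` cancelled by `b`, the letter `a` still stops at the same place: `a` precedes `c`,
      -- which precedes every letter at the front of `w`.
      refine (insertLetter_eq_cons h₁.2 fun d hd => trans_of lt h₂ ((hw.1 d hd).2 ?_)).symm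
      rw [h₄]
      exact h₃ d hd.mem
    · rw [insertLetter_of_lt h₁ h₂, insertLetter_of_lt h₃ h₄, key, insertLetter_of_lt h₃ h₄,
        insertLetter_of_lt (allAdj_cons.2 ⟨hba, h₁⟩) h]
    · rw [insertLetter_of_lt h₁ h₂, insertLetter_of_not h₃ h₄, key, insertLetter_of_not h₃ h₄,
        insertLetter_of_lt _ h₂]
      rw [allAdj_cons] at h₁ ⊢
      exact ⟨h₁.1, (allAdj_insertLetter_iff hba).2 h₁.2⟩
    · rw [insertLetter_of_not h₁ h₂, insertLetter_of_cancel h₃ h₄, insertLetter_of_cancel _ h₄]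
      exact (allAdj_insertLetter_iff hab).2 h₃
    · rw [insertLetter_of_not h₁ h₂, insertLetter_of_lt h₃ h₄, insertLetter_of_lt _ h₄,
        insertLetter_of_not, insertLetter_of_not h₁ h₂]
      · rintro ⟨-, rfl⟩
        exact Γ.irrefl hab
      · exact fun h' => h₂ ⟨(allAdj_cons.1 h'.1).2, trans_of lt h h₄⟩
      · rw [allAdj_cons] at h₃ ⊢
        exact ⟨h₃.1, (allAdj_insertLetter_iff hab).2 h₃.2⟩
    · rw [insertLetter_of_not h₁ h₂, insertLetter_of_not h₃ h₄, insertLetter_of_not,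
        insertLetter_of_not, insertLetter_comm_of_lt hlt hab h hw.2]
      · rwa [allAdj_insertLetter_iff hba]
      · rwa [allAdj_cons, allAdj_insertLetter_iff hba, ← allAdj_cons]
      · rwa [allAdj_insertLetter_iff hab]
      · rwa [allAdj_cons, allAdj_insertLetter_iff hab, ← allAdj_cons]

theorem insertLetter_comm (hlt : OrientsEdges Γ lt) {a b : V × Bool} (hab : Γ.Adj a.1 b.1)
    {w : List (V × Bool)} (hw : NormalWord Γ lt w) :
    insertLetter Γ lt b (insertLetter Γ lt a w) = insertLetter Γ lt a (insertLetter Γ lt b w) := by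
  rcases lt_or_lt_of_adj (lt := lt) hab with h | h
  · exact insertLetter_comm_of_lt hlt hab h hw
  · exact (insertLetter_comm_of_lt hlt hab.symm h hw).symm

theorem NormalWord.insertLetter_eq_append {a : V × Bool} : ∀ {w : List (V × Bool)},
    NormalWord Γ lt (w ++ [a]) → RightAngledArtin.insertLetter Γ lt a w = w ++ [a]
  | [], _ => rfl
  | c :: w, h => by
    rw [insertLetter_of_not, NormalWord.insertLetter_eq_append h.2, List.cons_append]
    · rintro ⟨h₁, rfl⟩
      exact (h.1 a (h₁.front_append (front_singleton a))).1 (by simp)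
    · rintro ⟨h₁, h₂⟩
      rw [allAdj_cons] at h₁
      exact asymm_of lt h₂ ((h.1 a (h₁.2.front_append (front_singleton a))).2 h₁.1.symm)

/-! ### The group action and uniqueness of normal words -/

/-- Right multiplication by a letter as a permutation of the normal words. -/
noncomputable def insertPerm (Γ : SimpleGraph V) (lt : V × Bool → V × Bool → Prop)
    [IsStrictTotalOrder (V × Bool) lt] (a : V × Bool) :
    Equiv.Perm {w : List (V × Bool) // NormalWord Γ lt w} where
  toFun w := ⟨insertLetter Γ lt a w.1, w.2.insertLetter⟩
  invFun w := ⟨insertLetter Γ lt (letterInv a) w.1, w.2.insertLetter⟩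
  left_inv w := Subtype.ext (insertLetter_letterInv_insertLetter a w.2)
  right_inv w := Subtype.ext (by
    simpa using insertLetter_letterInv_insertLetter (letterInv a) w.2)

theorem insertPerm_letterInv (a : V × Bool) :
    insertPerm Γ lt (letterInv a) = (insertPerm Γ lt a)⁻¹ := by
  ext w
  rfl

theorem insertPerm_commute (hlt : OrientsEdges Γ lt) {a b : V × Bool} (hab : Γ.Adj a.1 b.1) :
    Commute (insertPerm Γ lt a) (insertPerm Γ lt b) := by
  ext w : 2
  exact (insertLetter_comm hlt hab w.2).symm

/-- The action of the right-angled Artin group by right multiplication on normal words. -/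
noncomputable def normalAction (hlt : OrientsEdges Γ lt) :
    -- The opposite group appears because right multiplications compose in reverse order.
    Grp Γ →* (Equiv.Perm {w : List (V × Bool) // NormalWord Γ lt w})ᵐᵒᵖ :=
  PresentedGroup.toGroup (f := fun x => MulOpposite.op (insertPerm Γ lt (x, true))) (by
    rintro _ ⟨x, y, h, rfl⟩
    have := (insertPerm_commute hlt (a := (x, true)) (b := (y, true)) h).op
    simp only [map_mul, map_inv, FreeGroup.lift_apply_of]
    rw [this.eq]
    group)

theorem value_nil : value Γ [] = 1 := rfl

theorem value_append (u v : List (V × Bool)) : value Γ (u ++ v) = value Γ u * value Γ v := by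
  simp only [value, ← FreeGroup.mul_mk, map_mul]

theorem value_cons (a : V × Bool) (v : List (V × Bool)) :
    value Γ (a :: v) = value Γ [a] * value Γ v := value_append [a] v

theorem value_letterInv (a : V × Bool) : value Γ [letterInv a] = (value Γ [a])⁻¹ := by
  rw [value, value, ← map_inv, FreeGroup.inv_mk]
  rfl

theorem normalAction_value_singleton (hlt : OrientsEdges Γ lt) (a : V × Bool) :
    normalAction hlt (value Γ [a]) = MulOpposite.op (insertPerm Γ lt a) := by
  have key (x : V) : normalAction hlt (value Γ [(x, true)]) =
      MulOpposite.op (insertPerm Γ lt (x, true)) := PresentedGroup.toGroup.of _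
  rcases a with ⟨x, _ | _⟩
  · have h₁ : value Γ [(x, false)] = (value Γ [(x, true)])⁻¹ := value_letterInv (x, true)
    have h₂ : insertPerm Γ lt (x, false) = (insertPerm Γ lt (x, true))⁻¹ :=
      insertPerm_letterInv (x, true)
    rw [h₁, map_inv, key, h₂, MulOpposite.op_inv]
  · exact key x

theorem normalAction_value_apply (hlt : OrientsEdges Γ lt) {w v : List (V × Bool)}
    (h : NormalWord Γ lt v) (hvw : NormalWord Γ lt (v ++ w)) :
    ((normalAction hlt (value Γ w)).unop ⟨v, h⟩).1 = v ++ w := by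
  induction w generalizing v with
  | nil => simp [value_nil]
  | cons a w ih =>
    have h₁ : NormalWord Γ lt ((v ++ [a]) ++ w) := by simpa using hvw
    have h₂ := h₁.of_append_left
    have h₃ : insertPerm Γ lt a ⟨v, h⟩ = ⟨v ++ [a], h₂⟩ :=
      Subtype.ext h₂.insertLetter_eq_append
    rw [value_cons, map_mul, normalAction_value_singleton, MulOpposite.unop_mul,
      MulOpposite.unop_op, Equiv.Perm.mul_apply, h₃, ih h₂ h₁]
    simp

/-- An element of the group is represented by at most one normal word. -/
theorem NormalWord.eq_of_value_eq (hlt : OrientsEdges Γ lt) {w w' : List (V × Bool)}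
    (hw : NormalWord Γ lt w) (hw' : NormalWord Γ lt w') (h : value Γ w = value Γ w') :
    w = w' := by
  have h₁ := normalAction_value_apply hlt (v := []) trivial hw
  have h₂ := normalAction_value_apply hlt (v := []) trivial hw'
  rw [h] at h₁
  exact h₁.symm.trans h₂

end NormalWords

end RightAngledArtin

/-! ### General facts on rewriting -/

namespace KnuthBendix

section Rewriting

variable {α : Type*} {S S' : Set (Rule α)}

theorem Reduces.mono (h : S ⊆ S') {a b : List α} : Reduces S a b → Reduces S' a b := by
  rintro ⟨p, q, ρ, hρ, h₁, h₂⟩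
  exact ⟨p, q, ρ, h hρ, h₁, h₂⟩

theorem ReducesStar.mono (h : S ⊆ S') {a b : List α} (hab : ReducesStar S a b) :
    ReducesStar S' a b :=
  Relation.ReflTransGen.mono (fun _ _ => Reduces.mono h) _ _ hab

theorem reduces_of_mem {ρ : Rule α} (h : ρ ∈ S) : Reduces S ρ.1 ρ.2 :=
  ⟨[], [], ρ, h, by simp, by simp⟩

theorem Reduces.append {a b : List α} (p q : List α) :
    Reduces S a b → Reduces S (p ++ a ++ q) (p ++ b ++ q) := by
  rintro ⟨p', q', ρ, hρ, rfl, rfl⟩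
  exact ⟨p ++ p', q' ++ q, ρ, hρ, by simp, by simp⟩

theorem Equivalent.append {a b : List α} (p q : List α) (h : Equivalent S a b) :
    Equivalent S (p ++ a ++ q) (p ++ b ++ q) := by
  induction h with
  | rel a b h => exact .rel _ _ (h.append p q)
  | refl a => exact .refl _
  | symm a b _ ih => exact ih.symm
  | trans a b c _ _ ih₁ ih₂ => exact ih₁.trans _ _ _ ih₂

theorem ReducesStar.equivalent {a b : List α} (h : ReducesStar S a b) : Equivalent S a b := by
  induction h with
  | refl => exact .refl _
  | tail _ h ih => exact ih.trans _ _ _ (.rel _ _ h)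

theorem Equivalent.of_rules (h : ∀ ρ ∈ S, Equivalent S' ρ.1 ρ.2) {a b : List α}
    (hab : Equivalent S a b) : Equivalent S' a b := by
  induction hab with
  | rel a b hab =>
    obtain ⟨p, q, ρ, hρ, rfl, rfl⟩ := hab
    exact (h ρ hρ).append p q
  | refl a => exact .refl _
  | symm a b _ ih => exact ih.symm
  | trans a b c _ _ ih₁ ih₂ => exact ih₁.trans _ _ _ ih₂

theorem Terminating.exists_irreducible (h : Terminating S) (w : List α) :
    ∃ z, ReducesStar S w z ∧ Irreducible S z := by
  by_contra! hw
  have step (z : {z // ReducesStar S w z}) :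
      ∃ z' : {z // ReducesStar S w z}, Reduces S z.1 z'.1 := by
    obtain ⟨z', hz'⟩ := not_not.1 (hw z.1 z.2)
    exact ⟨⟨z', z.2.tail hz'⟩, hz'⟩
  choose f hf using step
  refine h ⟨fun n => (f^[n] ⟨w, .refl⟩).1, fun n => ?_⟩
  simp only [Function.iterate_succ_apply']
  exact hf _

theorem terminating_of_wellFounded {r : List α → List α → Prop} (hr : WellFounded r)
    (h : ∀ a b, Reduces S a b → r b a) : Terminating S := by
  rintro ⟨f, hf⟩
  obtain ⟨_, ⟨n, rfl⟩, hn⟩ := hr.has_min (Set.range f) ⟨f 0, 0, rfl⟩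
  exact hn _ ⟨n + 1, rfl⟩ (h _ _ (hf n))

end Rewriting

end KnuthBendix

/-! ### The normal rules and their completeness -/

namespace RightAngledArtin

open KnuthBendix

section NormalRules

variable {V : Type*} (Γ : SimpleGraph V) (lt : V × Bool → V × Bool → Prop)

/-- The rules `u x → x u` which satisfy the condition on prefixes and for which `u` is normal. -/
def normalRules : Set (Rule (V × Bool)) :=
  {ρ | ∃ (u : List (V × Bool)) (x : V × Bool), ρ = (u ++ [x], x :: u) ∧
    PrefixCondition (commRules Γ lt) u x ∧ NormalWord Γ lt u}

/-- The normal rules with sides of length at most `n + 2`, and the rules of free reduction. -/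
def boundedRules (n : ℕ) : Set (Rule (V × Bool)) :=
  {ρ | ρ ∈ normalRules Γ lt ∧ ρ.1.length ≤ n + 2} ∪ freeRules V

variable {Γ lt}

theorem mem_commRules_iff {a b : V × Bool} :
    ([a, b], [b, a]) ∈ commRules Γ lt ↔ Γ.Adj a.1 b.1 ∧ lt b a := by
  constructor
  · rintro ⟨x, y, γ, ε, h, h', he⟩
    simp only [Prod.mk.injEq, List.cons.injEq, and_true] at he
    obtain ⟨⟨rfl, rfl⟩, -⟩ := he
    exact ⟨h, h'⟩
  · exact fun h => ⟨a.1, b.1, a.2, b.2, h.1, h.2, rfl⟩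

theorem mem_normalRules_iff {ρ : Rule (V × Bool)} : ρ ∈ normalRules Γ lt ↔
    ∃ (t : V × Bool) (ts : List (V × Bool)) (x : V × Bool), ρ = (t :: ts ++ [x], x :: t :: ts) ∧
      Γ.Adj t.1 x.1 ∧ lt x t ∧ AllAdj Γ x ts ∧ (∀ s ∈ ts, lt s x) ∧ NormalWord Γ lt (t :: ts) := by
  constructor
  · rintro ⟨_, x, rfl, ⟨t, ts, rfl, h₁, h₂⟩, h₃⟩
    rw [mem_commRules_iff] at h₁
    simp only [mem_commRules_iff] at h₂
    exact ⟨t, ts, x, rfl, h₁.1, h₁.2, fun s hs => (h₂ s hs).1.symm, fun s hs => (h₂ s hs).2, h₃⟩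
  · rintro ⟨t, ts, x, rfl, h₁, h₂, h₃, h₄, h₅⟩
    exact ⟨_, x, rfl, ⟨t, ts, rfl, mem_commRules_iff.2 ⟨h₁, h₂⟩, fun s hs =>
      mem_commRules_iff.2 ⟨(h₃ s hs).symm, h₄ s hs⟩⟩, h₅⟩

theorem commRules_subset_normalRules : commRules Γ lt ⊆ normalRules Γ lt := by
  rintro _ ⟨x, y, γ, ε, h, h', rfl⟩
  exact mem_normalRules_iff.2 ⟨(x, γ), [], (y, ε), rfl, h, h', allAdj_nil _, by simp,
    normalWord_singleton _⟩

theorem mem_commRules_of_length {ρ : Rule (V × Bool)} (h : ρ ∈ normalRules Γ lt)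
    (hl : ρ.1.length ≤ 2) : ρ ∈ commRules Γ lt := by
  obtain ⟨t, ts, x, rfl, h₁, h₂, -⟩ := mem_normalRules_iff.1 h
  have : ts = [] := by simpa using hl
  subst this
  exact mem_commRules_iff.2 ⟨h₁, h₂⟩

theorem two_le_length_of_mem_normalRules {ρ : Rule (V × Bool)} (h : ρ ∈ normalRules Γ lt) :
    2 ≤ ρ.1.length := by
  obtain ⟨t, ts, x, rfl, -⟩ := mem_normalRules_iff.1 h
  simp

theorem length_of_mem_freeRules {ρ : Rule (V × Bool)} (h : ρ ∈ freeRules V) :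
    ρ.1.length = 2 ∧ ρ.2.length = 0 := by
  obtain ⟨x, γ, rfl⟩ := h
  simp

theorem perm_of_mem_normalRules {ρ : Rule (V × Bool)} (h : ρ ∈ normalRules Γ lt) :
    ρ.1.Perm ρ.2 := by
  obtain ⟨u, x, rfl, -⟩ := h
  exact List.perm_append_singleton x u

theorem normalRules_disjoint_freeRules : Disjoint (normalRules Γ lt) (freeRules V) := by
  refine Set.disjoint_left.2 fun ρ h h' => ?_
  have h₁ := (perm_of_mem_normalRules h).length_eq
  have h₂ := length_of_mem_freeRules h'
  omega

theorem boundedRules_subset (n : ℕ) : boundedRules Γ lt n ⊆ normalRules Γ lt ∪ freeRules V :=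
  Set.union_subset_union_left _ fun _ h => h.1

theorem length_le_of_mem_boundedRules {n : ℕ} {ρ : Rule (V × Bool)}
    (h : ρ ∈ boundedRules Γ lt n) : ρ.1.length ≤ n + 2 := by
  rcases h with h | h
  · exact h.2
  · have := length_of_mem_freeRules h
    omega

theorem mem_boundedRules {n : ℕ} {ρ : Rule (V × Bool)} (h : ρ ∈ normalRules Γ lt ∪ freeRules V)
    (hl : ρ.1.length ≤ n + 2) : ρ ∈ boundedRules Γ lt n :=
  h.imp (fun h => ⟨h, hl⟩) id

theorem two_le_length_of_mem {ρ : Rule (V × Bool)} (h : ρ ∈ normalRules Γ lt ∪ freeRules V) :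
    2 ≤ ρ.1.length := by
  rcases h with h | h
  · exact two_le_length_of_mem_normalRules h
  · exact (length_of_mem_freeRules h).1.ge

theorem boundedRules_zero : boundedRules Γ lt 0 = commRules Γ lt ∪ freeRules V := by
  refine congrArg (· ∪ freeRules V) (Set.ext fun ρ => ⟨fun h => mem_commRules_of_length h.1 h.2,
    fun h => ⟨commRules_subset_normalRules h, ?_⟩⟩)
  obtain ⟨x, y, γ, ε, -, -, rfl⟩ := h
  simp

theorem length_le_of_mem {ρ : Rule (V × Bool)} (h : ρ ∈ normalRules Γ lt ∪ freeRules V) :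
    ρ.2.length ≤ ρ.1.length := by
  rcases h with h | h
  · exact (perm_of_mem_normalRules h).length_eq.ge
  · have := length_of_mem_freeRules h
    omega

theorem shortlex_of_reduces {a b : List (V × Bool)}
    (h : Reduces (normalRules Γ lt ∪ freeRules V) a b) : List.Shortlex lt b a := by
  obtain ⟨p, q, ρ, hρ | hρ, rfl, rfl⟩ := h
  · obtain ⟨t, ts, x, rfl, -, h₂, -⟩ := mem_normalRules_iff.1 hρ
    refine .of_lex (by simp; omega) ?_
    simp only [List.append_assoc, List.cons_append]
    exact List.Lex.append_left _ (.rel h₂) _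
  · have := length_of_mem_freeRules hρ
    refine .of_length_lt ?_
    simp only [List.length_append]
    omega

theorem shortlex_of_mem {ρ : Rule (V × Bool)} (h : ρ ∈ normalRules Γ lt ∪ freeRules V) :
    List.Shortlex lt ρ.2 ρ.1 := shortlex_of_reduces (reduces_of_mem h)

/-- Only free reduction shortens a word; without it the multiset of letters survives. This lets
letters be compared between a critical word and the rule it produces. -/
theorem length_lt_or_perm_of_reducesStar {a b : List (V × Bool)}
    (h : ReducesStar (normalRules Γ lt ∪ freeRules V) a b) : b.length < a.length ∨ a.Perm b := by
  induction h with
  | refl => exact Or.inr (.refl _)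
  | @tail b c _ h ih =>
    have h' : c.length < b.length ∨ b.Perm c := by
      obtain ⟨p, q, ρ, hρ | hρ, rfl, rfl⟩ := h
      · exact Or.inr (((perm_of_mem_normalRules hρ).append_left p).append_right q)
      · have := length_of_mem_freeRules hρ
        refine Or.inl ?_
        simp only [List.length_append]
        omega
    rcases ih with ih | ih <;> rcases h' with h' | h'
    · exact Or.inl (h'.trans ih)
    · exact Or.inl (h'.length_eq ▸ ih)
    · exact Or.inl (ih.length_eq ▸ h')
    · exact Or.inr (ih.trans h')

theorem length_le_of_reducesStar {a b : List (V × Bool)}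
    (h : ReducesStar (normalRules Γ lt ∪ freeRules V) a b) : b.length ≤ a.length := by
  rcases length_lt_or_perm_of_reducesStar h with h | h
  · exact h.le
  · exact h.length_eq.ge

theorem value_pair_comm {a b : V × Bool} (h : Γ.Adj a.1 b.1) : value Γ [a, b] = value Γ [b, a] := by
  rw [value_cons a [b], value_cons b [a]]
  have key (x : V) (y : V) (h : Γ.Adj x y) :
      Commute (value Γ [(x, true)]) (value Γ [(y, true)]) := by
    have : PresentedGroup.mk {c : FreeGroup V | ∃ x y, Γ.Adj x y ∧
        c = FreeGroup.of x * FreeGroup.of y * (FreeGroup.of x)⁻¹ * (FreeGroup.of y)⁻¹}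
        (FreeGroup.of x * FreeGroup.of y * (FreeGroup.of x)⁻¹ * (FreeGroup.of y)⁻¹) = 1 :=
      PresentedGroup.one_of_mem ⟨x, y, h, rfl⟩
    rw [map_mul, map_mul, map_mul, map_inv, map_inv, mul_inv_eq_one, mul_inv_eq_iff_eq_mul] at this
    exact this
  have inv (x : V) : value Γ [(x, false)] = (value Γ [(x, true)])⁻¹ := value_letterInv (x, true)
  obtain ⟨x, γ⟩ := a
  obtain ⟨y, ε⟩ := b
  change Commute _ _
  cases γ <;> cases ε <;> simpa [inv] using key x y h

theorem value_eq_of_equivalent {w w' : List (V × Bool)}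
    (h : Equivalent (commRules Γ lt ∪ freeRules V) w w') : value Γ w = value Γ w' := by
  induction h with
  | rel a b h =>
    obtain ⟨p, q, ρ, hρ, rfl, rfl⟩ := h
    rw [value_append, value_append, value_append, value_append]
    congr 2
    rcases hρ with ⟨x, y, γ, ε, h, -, rfl⟩ | ⟨x, γ, rfl⟩
    · exact value_pair_comm h
    · rw [value_cons, value_nil, show (x, !γ) = letterInv (x, γ) from rfl, value_letterInv,
        mul_inv_cancel]
  | refl a => rfl
  | symm a b _ ih => exact ih.symm
  | trans a b c _ _ ih₁ ih₂ => exact ih₁.trans ih₂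

variable [IsStrictTotalOrder (V × Bool) lt]

theorem equivalent_pair {a b : V × Bool} (h : Γ.Adj a.1 b.1) :
    Equivalent (commRules Γ lt ∪ freeRules V) [a, b] [b, a] := by
  rcases lt_or_lt_of_adj (lt := lt) h with h' | h'
  · exact .symm _ _ (.rel _ _ (reduces_of_mem (ρ := ([b, a], [a, b]))
      (Or.inl (mem_commRules_iff.2 ⟨h.symm, h'⟩))))
  · exact .rel _ _ (reduces_of_mem (ρ := ([a, b], [b, a])) (Or.inl (mem_commRules_iff.2 ⟨h, h'⟩)))

theorem AllAdj.equivalent {x : V × Bool} : ∀ {u : List (V × Bool)}, AllAdj Γ x u →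
    Equivalent (commRules Γ lt ∪ freeRules V) (u ++ [x]) (x :: u)
  | [], _ => .refl _
  | c :: u, h => by
    rw [allAdj_cons] at h
    have h₁ := (h.2.equivalent).append [c] []
    have h₂ := (equivalent_pair (lt := lt) h.1).append [] u
    simp only [List.append_nil] at h₁
    exact h₁.trans _ _ _ h₂

theorem equivalent_of_mem {ρ : Rule (V × Bool)} (h : ρ ∈ normalRules Γ lt ∪ freeRules V) :
    Equivalent (commRules Γ lt ∪ freeRules V) ρ.1 ρ.2 := by
  rcases h with h | h
  · obtain ⟨t, ts, x, rfl, h₁, -, h₂, -⟩ := mem_normalRules_iff.1 h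
    exact (allAdj_cons.2 ⟨h₁, h₂⟩).equivalent
  · exact .rel _ _ (reduces_of_mem (Or.inr h))

theorem equivalent_iff_equivalent {w w' : List (V × Bool)} :
    Equivalent (normalRules Γ lt ∪ freeRules V) w w' ↔
      Equivalent (commRules Γ lt ∪ freeRules V) w w' :=
  ⟨.of_rules fun _ => equivalent_of_mem, .of_rules fun _ h =>
    .rel _ _ (reduces_of_mem (Set.union_subset_union_left _ commRules_subset_normalRules h))⟩

theorem value_eq_of_reducesStar {w w' : List (V × Bool)}
    (h : ReducesStar (normalRules Γ lt ∪ freeRules V) w w') : value Γ w = value Γ w' :=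
  value_eq_of_equivalent (equivalent_iff_equivalent.1 h.equivalent)

/-- The right-hand side of a normal rule is a normal word. -/
theorem normalWord_of_mem_normalRules {ρ : Rule (V × Bool)} (h : ρ ∈ normalRules Γ lt) :
    NormalWord Γ lt ρ.2 := by
  obtain ⟨t, ts, x, rfl, h₁, h₂, h₃, h₄, h₅⟩ := mem_normalRules_iff.1 h
  refine ⟨fun b hb => ⟨(allAdj_cons.2 ⟨h₁, h₃⟩).ne_letterInv_of_mem hb.mem, fun _ => ?_⟩, h₅⟩
  rcases hb with rfl | ⟨hbt, hb⟩
  · exact h₂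
  -- Impossible case: `b < x < t` by the condition on prefixes, while normality of `t :: ts` gives
  -- `t < b`.
  · exact (asymm_of lt (trans_of lt (h₄ b hb.mem) h₂) ((h₅.1 b hb).2 hbt)).elim

theorem not_normalWord_of_mem {ρ : Rule (V × Bool)} (h : ρ ∈ normalRules Γ lt ∪ freeRules V) :
    ¬ NormalWord Γ lt ρ.1 := by
  intro hn
  rcases h with h | ⟨x, γ, rfl⟩
  · obtain ⟨t, ts, x, rfl, h₁, h₂, h₃, -⟩ := mem_normalRules_iff.1 h
    exact asymm_of lt h₂ ((hn.1 x (h₃.front_append (front_singleton x))).2 h₁.symm)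
  · exact (hn.1 _ (front_singleton _)).1 rfl

theorem NormalWord.irreducible {w : List (V × Bool)} (h : NormalWord Γ lt w) :
    Irreducible (normalRules Γ lt ∪ freeRules V) w := by
  rintro ⟨_, p, q, ρ, hρ, rfl, -⟩
  exact not_normalWord_of_mem hρ h.of_append_left.of_append_right

/-- A word that is not normal contains the left-hand side of a rule. -/
theorem exists_factor_of_not_normalWord (hlt : OrientsEdges Γ lt) {w : List (V × Bool)}
    (h : ¬ NormalWord Γ lt w) :
    ∃ p q, ∃ ρ ∈ normalRules Γ lt ∪ freeRules V, w = p ++ ρ.1 ++ q := by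
  induction hn : w.length using Nat.strong_induction_on generalizing w with
  | _ n ih =>
    -- Induction reduces to words all of whose relevant proper factors are normal.
    have step (p v q : List (V × Bool)) (hv : ¬ NormalWord Γ lt v) (hw : w = p ++ v ++ q)
        (hl : v.length < w.length) :
        ∃ p q, ∃ ρ ∈ normalRules Γ lt ∪ freeRules V, w = p ++ ρ.1 ++ q := by
      obtain ⟨p', q', ρ, hρ, rfl⟩ := ih _ (hn ▸ hl) hv rfl
      exact ⟨p ++ p', q' ++ q, ρ, hρ, by simp [hw]⟩
    obtain _ | ⟨c, w⟩ := w
    · exact (h trivial).elim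
    by_cases hw : NormalWord Γ lt w
    swap
    · exact step [c] w [] hw (by simp) (by simp)
    have h' : ∃ a, Front Γ a w ∧ (a = letterInv c ∨ Γ.Adj a.1 c.1 ∧ ¬ lt c a) := by
      by_contra! h'
      exact h ⟨h', hw⟩
    obtain ⟨a, ha, hac⟩ := h'
    obtain ⟨u, v, rfl, hu⟩ := ha.exists_append
    by_cases hcu : NormalWord Γ lt (c :: u)
    swap
    · exact step [] (c :: u) (a :: v) hcu (by simp) (by simp)
    rcases hac with rfl | ⟨hac, hca⟩
    · obtain _ | ⟨d, u⟩ := u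
      · exact ⟨[], v, ([c, letterInv c], []), Or.inr ⟨c.1, c.2, rfl⟩, rfl⟩
      · have hcd : Γ.Adj c.1 d.1 := (allAdj_cons.1 hu).1.symm
        have hd : lt d (letterInv c) :=
          (hw.1 _ ((allAdj_cons.1 hu).2.front_append (front_cons_self _ v))).2 hcd
        refine ⟨[], u ++ letterInv c :: v, ([c, d], [d, c]),
          Or.inl (commRules_subset_normalRules (mem_commRules_iff.2 ⟨hcd, ?_⟩)), by simp⟩
        -- Normality of the tail gives `d` below the inverse of `c`; uniform orientation transfers
        -- this to `c`, so `c d` is already reducible.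
        exact hlt c.1 d.1 (!c.2) d.2 c.2 d.2 hcd hd
    · refine ⟨[], v, (c :: u ++ [a], a :: c :: u), Or.inl (mem_normalRules_iff.2
        ⟨c, u, a, rfl, hac.symm, (lt_or_lt_of_adj hac).resolve_right hca, hu, fun s hs => ?_, hcu⟩),
        by simp⟩
      obtain ⟨u₁, u₂, rfl⟩ := List.append_of_mem hs
      have h₁ : NormalWord Γ lt (s :: (u₂ ++ a :: v)) := by
        refine NormalWord.of_append_right (p := u₁) ?_
        simpa using hw
      have h₂ : AllAdj Γ a u₂ := fun b hb => hu b (by simp [hb])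
      exact (h₁.1 a (h₂.front_append (front_cons_self a v))).2 (hu s hs).symm

theorem normalWord_iff_irreducible (hlt : OrientsEdges Γ lt) {w : List (V × Bool)} :
    NormalWord Γ lt w ↔ Irreducible (normalRules Γ lt ∪ freeRules V) w := by
  refine ⟨NormalWord.irreducible, fun h => ?_⟩
  by_contra hw
  obtain ⟨p, q, ρ, hρ, rfl⟩ := exists_factor_of_not_normalWord hlt hw
  exact h ⟨_, p, q, ρ, hρ, rfl, rfl⟩

theorem terminating_normalRules [Finite V] : Terminating (normalRules Γ lt ∪ freeRules V) :=
  terminating_of_wellFounded (List.Shortlex.wf (Finite.wellFounded_of_trans_of_irrefl lt))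
    fun _ _ => shortlex_of_reduces

theorem exists_normalWord [Finite V] (hlt : OrientsEdges Γ lt) (w : List (V × Bool)) :
    ∃ z, ReducesStar (normalRules Γ lt ∪ freeRules V) w z ∧ NormalWord Γ lt z := by
  simp only [normalWord_iff_irreducible hlt]
  exact terminating_normalRules.exists_irreducible w

theorem joinable_of_value_eq [Finite V] (hlt : OrientsEdges Γ lt) {a b : List (V × Bool)}
    (h : value Γ a = value Γ b) : Joinable (normalRules Γ lt ∪ freeRules V) a b := by
  obtain ⟨z, haz, hz⟩ := exists_normalWord hlt a
  obtain ⟨z', hbz', hz'⟩ := exists_normalWord hlt b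
  have : z = z' := hz.eq_of_value_eq hlt hz' (by rw [← value_eq_of_reducesStar haz, ← value_eq_of_reducesStar hbz', h])
  exact ⟨z, haz, this ▸ hbz'⟩

theorem complete_normalRules [Finite V] (hlt : OrientsEdges Γ lt) :
    Complete (normalRules Γ lt ∪ freeRules V) :=
  ⟨terminating_normalRules, fun _ _ _ ha hb =>
    joinable_of_value_eq hlt ((value_eq_of_reducesStar ha).symm.trans (value_eq_of_reducesStar hb))⟩

theorem equivalent_iff_value_eq [Finite V] (hlt : OrientsEdges Γ lt) {w w' : List (V × Bool)} :
    Equivalent (normalRules Γ lt ∪ freeRules V) w w' ↔ value Γ w = value Γ w' := by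
  refine ⟨fun h => value_eq_of_equivalent (equivalent_iff_equivalent.1 h), fun h => ?_⟩
  obtain ⟨z, h₁, h₂⟩ := joinable_of_value_eq hlt h
  exact h₁.equivalent.trans _ _ _ h₂.equivalent.symm

end NormalRules

end RightAngledArtin

/-! ### Overlaps and the rules they produce -/

namespace KnuthBendix

section Overlaps

variable {α : Type*} {S : Set (Rule α)} {lt : α → α → Prop}
  {nf : Set (Rule α) → List α → List α}

theorem Overlap.length_eq (o : Overlap α) :
    o.length = o.left.1.length + o.w.length ∧ o.length = o.u.length + o.right.1.length := by
  simp [Overlap.length, Overlap.left, Overlap.right, add_assoc]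

theorem Overlap.IsIn.length_lt {o : Overlap α} (h : o.IsIn S) :
    o.left.1.length < o.length ∧ o.right.1.length < o.length := by
  have h₁ := o.length_eq
  have h₂ := List.length_pos_iff.2 h.1
  have h₃ := List.length_pos_iff.2 h.2.2.1
  omega

theorem Overlap.crit_length (o : Overlap α) :
    o.crit₁.length + o.left.1.length = o.length + o.left.2.length ∧
      o.crit₂.length + o.right.1.length = o.length + o.right.2.length := by
  simp only [Overlap.length, Overlap.left, Overlap.right, Overlap.crit₁, Overlap.crit₂,
    List.length_append]
  omega

theorem Overlap.IsIn.mono {S' : Set (Rule α)} (hS : S ⊆ S') {o : Overlap α} (h : o.IsIn S) :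
    o.IsIn S' := ⟨h.1, h.2.1, h.2.2.1, hS h.2.2.2.1, hS h.2.2.2.2⟩

theorem Overlap.resolves_of_nf_eq {o : Overlap α} (hn : ∀ w, ReducesStar S w (nf S w))
    (h : nf S o.crit₁ = nf S o.crit₂) : o.Resolves S :=
  ⟨_, hn _, h ▸ hn _⟩

theorem exists_produces_of_nf_ne [Std.Trichotomous lt] {o : Overlap α}
    (h : nf S o.crit₁ ≠ nf S o.crit₂) : ∃ ρ, Produces lt nf S o ρ := by
  rcases trichotomous_of (List.Shortlex lt) (nf S o.crit₁) (nf S o.crit₂) with h' | h' | h'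
  · exact ⟨(_, _), h', Or.inr rfl⟩
  · exact (h h').elim
  · exact ⟨(_, _), h', Or.inl rfl⟩

theorem exists_next_of_treated {S₀ : Set (Rule α)} {o : Overlap α} {n : ℕ}
    (h : o ∈ (run lt nf S₀ n).treated) : ∃ m, o ∈ (run lt nf S₀ m).next := by
  induction n with
  | zero => exact h.elim
  | succ n ih => exact h.elim ih fun h => ⟨n, h⟩

theorem Irreducible.eq_of_reducesStar {w z : List α} (h : Irreducible S w)
    (hz : ReducesStar S w z) : z = w := by
  rcases Relation.ReflTransGen.cases_head hz with rfl | ⟨y, hy, -⟩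
  · rfl
  · exact (h ⟨y, hy⟩).elim

theorem Irreducible.anti {S' : Set (Rule α)} (hS : S ⊆ S') {w : List α} (h : Irreducible S' w) :
    Irreducible S w := fun ⟨z, hz⟩ => h ⟨z, hz.mono hS⟩

end Overlaps

-- One completion step over the bounded rules

end KnuthBendix

namespace RightAngledArtin

open KnuthBendix

section Completion

variable {V : Type*} {Γ : SimpleGraph V} {lt : V × Bool → V × Bool → Prop}
  {nf : Set (Rule (V × Bool)) → List (V × Bool) → List (V × Bool)}

/-- The critical words of an overlap of normal and free rules represent the same element. -/
theorem value_crit_eq [IsStrictTotalOrder (V × Bool) lt] {o : Overlap (V × Bool)}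
    (h : o.IsIn (normalRules Γ lt ∪ freeRules V)) : value Γ o.crit₁ = value Γ o.crit₂ := by
  have h₁ := value_eq_of_equivalent (equivalent_of_mem h.2.2.2.1)
  have h₂ := value_eq_of_equivalent (equivalent_of_mem h.2.2.2.2)
  simp only [Overlap.left, Overlap.right, value_append] at h₁ h₂
  rw [Overlap.crit₁, Overlap.crit₂, value_append, value_append, ← h₁, ← h₂, mul_assoc]

theorem crit_length_le {o : Overlap (V × Bool)}
    (h : o.IsIn (normalRules Γ lt ∪ freeRules V)) :
    o.crit₁.length ≤ o.length ∧ o.crit₂.length ≤ o.length := by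
  have h₁ := length_le_of_mem h.2.2.2.1
  have h₂ := length_le_of_mem h.2.2.2.2
  have h₃ := o.crit_length
  omega

theorem nf_boundedRules (hnf : IsNormalizer lt nf) (n : ℕ) (w : List (V × Bool)) :
    ReducesStar (boundedRules Γ lt n) w (nf (boundedRules Γ lt n) w) ∧
      Irreducible (boundedRules Γ lt n) (nf (boundedRules Γ lt n) w) :=
  hnf _ (fun _ hρ => shortlex_of_mem (boundedRules_subset n hρ)) w

theorem reducesStar_nf_boundedRules (hnf : IsNormalizer lt nf) (n : ℕ) (w : List (V × Bool)) :
    ReducesStar (normalRules Γ lt ∪ freeRules V) w (nf (boundedRules Γ lt n) w) :=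
  (nf_boundedRules hnf n w).1.mono (boundedRules_subset n)

/-- Prefixes of left-hand sides of normal rules give shorter normal rules. -/
theorem exists_mem_normalRules_of_length {ρ : Rule (V × Bool)} (hρ : ρ ∈ normalRules Γ lt) {k : ℕ}
    (hk : 2 ≤ k) (hkl : k ≤ ρ.1.length) : ∃ ρ' ∈ normalRules Γ lt, ρ'.1.length = k := by
  obtain ⟨t, ts, x, rfl, h₁, h₂, h₃, h₄, h₅⟩ := mem_normalRules_iff.1 hρ
  refine ⟨(t :: ts.take (k - 2) ++ [x], x :: t :: ts.take (k - 2)), mem_normalRules_iff.2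
    ⟨t, _, x, rfl, h₁, h₂, fun s hs => h₃ s (List.mem_of_mem_take hs),
      fun s hs => h₄ s (List.mem_of_mem_take hs), ?_⟩, ?_⟩
  · refine NormalWord.of_append_left (q := ts.drop (k - 2)) ?_
    rwa [List.cons_append, List.take_append_drop]
  · simp at hkl ⊢
    omega

variable [IsStrictTotalOrder (V × Bool) lt]

/-- A word that is irreducible modulo the bounded rules but not normal is, if it is not too long,
the left-hand side of a normal rule. -/
theorem mem_normalRules_of_irreducible (hlt : OrientsEdges Γ lt) {n : ℕ} {w : List (V × Bool)}
    (hw : Irreducible (boundedRules Γ lt n) w) (hn : ¬ NormalWord Γ lt w) :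
    ∃ ρ ∈ normalRules Γ lt, n + 3 ≤ ρ.1.length ∧ ρ.1.length ≤ w.length ∧
      (w.length ≤ n + 3 → ρ.1 = w) := by
  obtain ⟨p, q, ρ, hρ, rfl⟩ := exists_factor_of_not_normalWord hlt hn
  have hl : n + 3 ≤ ρ.1.length := by
    by_contra hl
    exact hw ⟨_, p, q, ρ, mem_boundedRules hρ (by omega), rfl, rfl⟩
  have hρ' : ρ ∈ normalRules Γ lt := hρ.resolve_right fun h => by
    have := length_of_mem_freeRules h
    omega
  refine ⟨ρ, hρ', hl, by simp; omega, fun h => ?_⟩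
  simp only [List.length_append] at h
  have hp : p = [] := List.length_eq_zero_iff.1 (by omega)
  have hq : q = [] := List.length_eq_zero_iff.1 (by omega)
  simp [hp, hq]

/-- Two different irreducible words for the bounded rules that represent the same element form a
normal rule, of length greater by one than the bound. -/
theorem mem_normalRules_of_shortlex (hlt : OrientsEdges Γ lt) {n : ℕ} {p q : List (V × Bool)}
    (hp : Irreducible (boundedRules Γ lt n) p) (hq : Irreducible (boundedRules Γ lt n) q)
    (hpl : p.length ≤ n + 3) (hql : q.length ≤ n + 3) (h : value Γ p = value Γ q)
    (hqp : List.Shortlex lt q p) : (p, q) ∈ normalRules Γ lt ∧ p.length = n + 3 := by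
  have rhs {ρ : Rule (V × Bool)} (hρ : ρ ∈ normalRules Γ lt) : value Γ ρ.1 = value Γ ρ.2 :=
    value_eq_of_equivalent (equivalent_of_mem (Or.inl hρ))
  by_cases hpn : NormalWord Γ lt p
  · by_cases hqn : NormalWord Γ lt q
    · rw [hpn.eq_of_value_eq hlt hqn h] at hqp
      exact (asymm_of (List.Shortlex lt) hqp hqp).elim
    · obtain ⟨ρ, hρ, -, -, hw⟩ := mem_normalRules_of_irreducible hlt hq hqn
      obtain rfl := hw hql
      rw [hpn.eq_of_value_eq hlt (normalWord_of_mem_normalRules hρ) (h.trans (rhs hρ))] at hqp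
      -- Here `p` would be the right-hand side of the rule for `q`, against `q < p`.
      exact (asymm_of (List.Shortlex lt) hqp (shortlex_of_mem (Or.inl hρ))).elim
  · obtain ⟨ρ, hρ, hl, -, hw⟩ := mem_normalRules_of_irreducible hlt hp hpn
    obtain rfl := hw hpl
    refine ⟨?_, le_antisymm hpl hl⟩
    by_cases hqn : NormalWord Γ lt q
    · rw [hqn.eq_of_value_eq hlt (normalWord_of_mem_normalRules hρ) (h.symm.trans (rhs hρ))]
      exact hρ
    · obtain ⟨ρ', hρ', -, -, hw'⟩ := mem_normalRules_of_irreducible hlt hq hqn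
      obtain rfl := hw' hql
      -- If both are left-hand sides, their right-hand sides are equal normal words, and `x u`
      -- determines `u x`, so `p = q`.
      have := (normalWord_of_mem_normalRules hρ).eq_of_value_eq hlt
        (normalWord_of_mem_normalRules hρ') (by rw [← rhs hρ, ← rhs hρ', h])
      obtain ⟨u, x, rfl, -⟩ := hρ
      obtain ⟨u', x', rfl, -⟩ := hρ'
      obtain ⟨rfl, rfl⟩ := List.cons.inj this
      exact (asymm_of (List.Shortlex lt) hqp hqp).elim

/-- A rule produced over the bounded rules by a short overlap is a normal rule. -/
theorem mem_normalRules_of_produces (hlt : OrientsEdges Γ lt) (hnf : IsNormalizer lt nf) {n : ℕ}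
    {o : Overlap (V × Bool)} {ρ : Rule (V × Bool)} (ho : o.IsIn (boundedRules Γ lt n))
    (hl : o.length ≤ n + 3) (hρ : Produces lt nf (boundedRules Γ lt n) o ρ) :
    ρ ∈ normalRules Γ lt ∧ ρ.1.length = n + 3 := by
  have ho' := ho.mono (boundedRules_subset n)
  have hc := crit_length_le ho'
  have h₁ := reducesStar_nf_boundedRules (Γ := Γ) hnf n o.crit₁
  have h₂ := reducesStar_nf_boundedRules (Γ := Γ) hnf n o.crit₂
  have hl₁ := (length_le_of_reducesStar h₁).trans (hc.1.trans hl)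
  have hl₂ := (length_le_of_reducesStar h₂).trans (hc.2.trans hl)
  have hv : value Γ (nf (boundedRules Γ lt n) o.crit₁) =
      value Γ (nf (boundedRules Γ lt n) o.crit₂) := by
    rw [← value_eq_of_reducesStar h₁, ← value_eq_of_reducesStar h₂, value_crit_eq ho']
  obtain ⟨hs, rfl | rfl⟩ := hρ
  · exact mem_normalRules_of_shortlex hlt (nf_boundedRules hnf n _).2 (nf_boundedRules hnf n _).2
      hl₁ hl₂ hv hs
  · exact mem_normalRules_of_shortlex hlt (nf_boundedRules hnf n _).2 (nf_boundedRules hnf n _).2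
      hl₂ hl₁ hv.symm hs

/-- If every normal rule were within the bound, all chosen normal forms would be normal words, and
both sides of the critical pair would agree. No bound on the overlap is assumed here. -/
theorem exists_length_of_produces (hlt : OrientsEdges Γ lt) (hnf : IsNormalizer lt nf) {n : ℕ}
    {o : Overlap (V × Bool)} {ρ : Rule (V × Bool)} (ho : o.IsIn (boundedRules Γ lt n))
    (hρ : Produces lt nf (boundedRules Γ lt n) o ρ) :
    ∃ ρ' ∈ normalRules Γ lt, n + 3 ≤ ρ'.1.length := by
  by_contra! h
  have hn (w : List (V × Bool)) : NormalWord Γ lt (nf (boundedRules Γ lt n) w) := by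
    by_contra hw
    obtain ⟨ρ', hρ', hl, -⟩ :=
      mem_normalRules_of_irreducible hlt (nf_boundedRules hnf n w).2 hw
    exact (h ρ' hρ').not_ge hl
  have : nf (boundedRules Γ lt n) o.crit₁ = nf (boundedRules Γ lt n) o.crit₂ :=
    (hn _).eq_of_value_eq hlt (hn _) (by
      rw [← value_eq_of_reducesStar (reducesStar_nf_boundedRules hnf n _),
        ← value_eq_of_reducesStar (reducesStar_nf_boundedRules hnf n _),
        value_crit_eq (ho.mono (boundedRules_subset n))])
  obtain ⟨hs, rfl | rfl⟩ := hρ <;> rw [this] at hs <;>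
    exact asymm_of (List.Shortlex lt) hs hs

omit [IsStrictTotalOrder (V × Bool) lt] in
theorem front_or_of_front_append {a : V × Bool} {v : List (V × Bool)} :
    ∀ {w : List (V × Bool)}, Front Γ a (w ++ v) → Front Γ a w ∨ Front Γ a v
  | [], h => Or.inr h
  | c :: w, h => by
    rcases h with h | ⟨h, h'⟩
    · exact Or.inl (Or.inl h)
    · exact (front_or_of_front_append h').imp_left fun h' => Or.inr ⟨h, h'⟩

omit [IsStrictTotalOrder (V × Bool) lt] in
theorem NormalWord.append_singleton {x : V × Bool} : ∀ {w : List (V × Bool)},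
    NormalWord Γ lt w → AllAdj Γ x w → (∀ c ∈ w, lt c x) → NormalWord Γ lt (w ++ [x])
  | [], _, _, _ => normalWord_singleton x
  | c :: w, h, h', hx => by
    rw [allAdj_cons] at h'
    refine ⟨fun a ha => ?_, h.2.append_singleton h'.2 fun d hd => hx d (by simp [hd])⟩
    rcases front_or_of_front_append ha with ha | ha | ha
    · exact h.1 a ha
    · subst ha
      refine ⟨?_, fun _ => hx c (by simp)⟩
      rintro rfl
      exact Γ.irrefl (v := c.1) h'.1
    · exact ha.2.elim

/-- The left-hand side of a normal rule contains no shorter left-hand side. -/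
theorem irreducible_boundedRules_of_mem {n : ℕ} {ρ : Rule (V × Bool)}
    (hρ : ρ ∈ normalRules Γ lt) (hl : ρ.1.length = n + 3) :
    Irreducible (boundedRules Γ lt n) ρ.1 := by
  obtain ⟨t, ts, x, rfl, -, -, h₃, h₄, h₅⟩ := mem_normalRules_iff.1 hρ
  rintro ⟨_, p, q, ρ', hρ', h, -⟩
  have hn := not_normalWord_of_mem (boundedRules_subset n hρ')
  -- A proper factor misses the first or the last letter, hence lies in `ts ++ [x]` or `t :: ts`,
  -- both normal; the whole word is too long for a bounded rule.
  rcases List.eq_nil_or_concat q with rfl | ⟨q, y, rfl⟩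
  · obtain _ | ⟨c, p⟩ := p
    · have h₁ := length_le_of_mem_boundedRules hρ'
      have h₂ := congrArg List.length h
      simp at h₂ hl
      omega
    · simp only [List.cons_append, List.append_nil, List.cons.injEq] at h
      have h₆ := h₅.2.append_singleton h₃ h₄
      rw [h.2] at h₆
      exact hn h₆.of_append_right
  · have h' : (t :: ts) ++ [x] = (p ++ ρ'.1 ++ q) ++ [y] := by simpa using h
    rw [(List.append_singleton_inj.1 h').1] at h₅
    exact hn h₅.of_append_left.of_append_right

/-- Every normal rule of length `n + 3` is produced by an overlap of a normal rule of length
`n + 2` with a commutation rule. -/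
theorem exists_overlap_produces (hnf : IsNormalizer lt nf) {n : ℕ}
    {ρ : Rule (V × Bool)} (hρ : ρ ∈ normalRules Γ lt) (hl : ρ.1.length = n + 3) :
    ∃ o : Overlap (V × Bool), o.IsIn (boundedRules Γ lt n) ∧ o.length = n + 3 ∧
      o.left ∈ normalRules Γ lt ∧ o.left.1.length = n + 2 ∧
      Produces lt nf (boundedRules Γ lt n) o ρ := by
  have hs := shortlex_of_mem (Or.inl hρ)
  have hi₁ := irreducible_boundedRules_of_mem hρ hl
  have hi₂ := (normalWord_of_mem_normalRules hρ).irreducible.anti (boundedRules_subset n)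
  obtain ⟨t, ts, x, rfl, h₁, h₂, h₃, h₄, h₅⟩ := mem_normalRules_iff.1 hρ
  rcases List.eq_nil_or_concat ts with rfl | ⟨us, y, rfl⟩
  · simp at hl
  have hl' : us.length = n := by simpa using hl
  have hleft : (t :: us ++ [x], x :: t :: us) ∈ normalRules Γ lt :=
    mem_normalRules_iff.2 ⟨t, us, x, rfl, h₁, h₂, fun s hs => h₃ s (by simp [hs]),
      fun s hs => h₄ s (by simp [hs]), NormalWord.of_append_left (q := [y]) (by simpa using h₅)⟩
  have hright : ([x, y], [y, x]) ∈ normalRules Γ lt := commRules_subset_normalRules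
    (mem_commRules_iff.2 ⟨(h₃ y (by simp)).symm, h₄ y (by simp)⟩)
  have hleft' := mem_boundedRules (n := n) (Or.inl hleft) (by simp [hl'])
  have hright' := mem_boundedRules (n := n) (Or.inl hright) (by simp)
  -- Both critical words are already irreducible over the bounded rules, so the choice of normal
  -- forms has no effect.
  let o : Overlap (V × Bool) := ⟨t :: us, [x], [y], x :: t :: us, [y, x]⟩
  have ho₁ : o.crit₁ = x :: t :: (us ++ [y]) := by simp [o, Overlap.crit₁]
  have ho₂ : o.crit₂ = t :: (us ++ [y]) ++ [x] := by simp [o, Overlap.crit₂]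
  simp only [List.concat_eq_append] at hi₁ hi₂ hs ⊢
  refine ⟨o, ⟨by simp [o], by simp [o], by simp [o], hleft', hright'⟩,
    by simp [o, Overlap.length, hl'], hleft, by simp [o, Overlap.left, hl'], hs, Or.inr ?_⟩
  rw [ho₁, ho₂, hi₁.eq_of_reducesStar (nf_boundedRules hnf n _).1,
    hi₂.eq_of_reducesStar (nf_boundedRules hnf n _).1]

/-- The two rules of an overlap which produces a rule are a normal rule, at left, and a
commutation rule, at right. -/
theorem mem_of_produces (hlt : OrientsEdges Γ lt) (hnf : IsNormalizer lt nf) {n : ℕ}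
    {o : Overlap (V × Bool)} {ρ : Rule (V × Bool)} (ho : o.IsIn (boundedRules Γ lt n))
    (hl : o.length = n + 3) (hρ : Produces lt nf (boundedRules Γ lt n) o ρ) :
    o.left ∈ normalRules Γ lt ∧ o.right ∈ commRules Γ lt := by
  obtain ⟨hρn, hρl⟩ := mem_normalRules_of_produces hlt hnf ho hl.le hρ
  have ho' := ho.mono (boundedRules_subset n)
  have hc := crit_length_le ho'
  have hcl := o.crit_length
  have hp := perm_of_mem_normalRules hρn
  have h₁ := reducesStar_nf_boundedRules (Γ := Γ) hnf n o.crit₁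
  have h₂ := reducesStar_nf_boundedRules (Γ := Γ) hnf n o.crit₂
  have hpn : ρ.1.Perm (nf (boundedRules Γ lt n) o.crit₁) ∧
      ρ.1.Perm (nf (boundedRules Γ lt n) o.crit₂) := by
    obtain ⟨-, h | h⟩ := hρ <;> rw [h] at hp ⊢
    · exact ⟨.refl _, hp⟩
    · exact ⟨hp, .refl _⟩
  have hl₁ := length_le_of_reducesStar h₁
  have hl₂ := length_le_of_reducesStar h₂
  have hl₃ := hpn.1.length_eq
  have hl₄ := hpn.2.length_eq
  have hleft : o.left ∈ normalRules Γ lt := ho'.2.2.2.1.resolve_right fun h => by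
    have := length_of_mem_freeRules h
    omega
  have hright : o.right ∈ normalRules Γ lt := ho'.2.2.2.2.resolve_right fun h => by
    have := length_of_mem_freeRules h
    omega
  refine ⟨hleft, mem_commRules_of_length hright ?_⟩
  have hperm : ρ.1.Perm o.crit₁ := by
    rcases length_lt_or_perm_of_reducesStar h₁ with h | h
    · omega
    · exact hpn.1.trans h.symm
  obtain ⟨hu, hv, hw, -⟩ := ho
  clear hρ hpn h₁ h₂ hl₁ hl₂ hl₃ hl₄ hcl hc ho' hp
  obtain ⟨u, v, w, r₁, r₂⟩ := o
  obtain ⟨t, ts, x, e₁, a₁, a₂, a₃, a₄, -⟩ := mem_normalRules_iff.1 hleft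
  obtain ⟨t', ts', x', e₂, -, b₂, b₃, b₄, b₅⟩ := mem_normalRules_iff.1 hright
  obtain ⟨c, cs, z, rfl, c₁, c₂, c₃, c₄, -⟩ := mem_normalRules_iff.1 hρn
  simp only [Overlap.left, Overlap.right, Prod.mk.injEq] at e₁ e₂
  obtain ⟨e₁, rfl⟩ := e₁
  obtain ⟨v, y, rfl⟩ := (List.eq_nil_or_concat v).resolve_left hv
  obtain ⟨w, y', rfl⟩ := (List.eq_nil_or_concat w).resolve_left hw
  simp only [List.concat_eq_append] at e₁ e₂ hperm ⊢
  obtain ⟨e₃, e₄⟩ := List.append_inj' (by simpa using e₁ : (u ++ v) ++ [y] = (t :: ts) ++ [x]) rfl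
  obtain ⟨e₅, e₆⟩ := List.append_inj'
    (by simpa using e₂.1 : (v ++ y :: w) ++ [y'] = (t' :: ts') ++ [x']) rfl
  obtain rfl : y = x := by simpa using e₄
  obtain rfl : y' = x' := by simpa using e₆
  -- The overlap is the single letter `y`: an extra first letter `b` would satisfy `b < y` by the
  -- left rule and `y < y' < b` by the right one.
  obtain _ | ⟨b, v⟩ := v
  swap
  · obtain _ | ⟨a, u⟩ := u
    · exact (hu rfl).elim
    simp only [List.cons_append, List.cons.injEq] at e₃ e₅
    have d₁ := a₄ b (by simp [← e₃.2])
    have d₂ := b₄ y (by simp [← e₅.2])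
    rw [← e₅.1] at b₂
    exact (asymm_of lt d₁ (trans_of lt d₂ b₂)).elim
  simp only [List.nil_append, List.cons.injEq] at e₅
  obtain ⟨rfl, rfl⟩ := e₅
  obtain _ | ⟨s, w⟩ := w
  · simp [Overlap.right]
  exfalso
  -- With right rule `y s w y'`, the largest letter is `t`, then `y`, and all others are below `y`.
  -- In the produced rule only `c` exceeds `z`.
  have hlet (e : V × Bool) (he : e ∈ c :: cs ++ [z]) : e = t ∨ e = y ∨ lt e y := by
    have := hperm.subset he
    simp only [Overlap.crit₁, List.mem_append, List.mem_cons, List.not_mem_nil, or_false] at this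
    rcases this with (rfl | rfl | h) | (h | rfl)
    · simp
    · simp
    · exact Or.inr (Or.inr (a₄ e h))
    · exact Or.inr (Or.inr (trans_of lt (b₄ e (by simpa using h)) b₂))
    · exact Or.inr (Or.inr b₂)
  have hmem (e : V × Bool) (he : e ∈ y :: t :: ts ++ (s :: w ++ [y'])) :
      e = c ∨ (lt e z ∧ Γ.Adj e.1 z.1) ∨ e = z := by
    have := hperm.symm.subset he
    simp only [List.mem_append, List.mem_cons, List.not_mem_nil, or_false] at this
    rcases this with (rfl | h) | rfl
    · simp
    · exact Or.inr (Or.inl ⟨c₄ e h, c₃ e h⟩)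
    · simp
  have hyt (h : lt t y) : False := asymm_of lt h a₂
  -- If `z = t`, nothing can be the larger `c`. If `z = y`, then `s` is among `cs`, hence adjacent
  -- to `y` and below it, against normality of `y s w`. If `z < y`, both `t` and `y` exceed `z`.
  rcases hlet z (by simp) with rfl | rfl | hzy
  · rcases hlet c (by simp) with rfl | rfl | h
    · exact irrefl_of lt _ c₂
    · exact hyt c₂
    · exact hyt (trans_of lt c₂ h)
  · have hsz : lt s z := trans_of lt (b₄ s (by simp)) b₂
    rcases hmem s (by simp) with rfl | h | rfl
    · exact asymm_of lt c₂ hsz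
    · exact asymm_of lt hsz ((b₅.1 s (front_cons_self s w)).2 h.2)
    · exact irrefl_of lt _ hsz
  · rcases hmem y (by simp) with rfl | h | rfl
    · rcases hmem t (by simp) with rfl | h | rfl
      · exact irrefl_of lt _ a₂
      · exact hyt (trans_of lt h.1 hzy)
      · exact hyt hzy
    · exact asymm_of lt h.1 hzy
    · exact irrefl_of lt _ hzy

/-! ### The invariant of the completion -/

/-- The state of the completion after `n` steps. -/
structure RunInvariant (Γ : SimpleGraph V) (lt : V × Bool → V × Bool → Prop) (n : ℕ)
    (s : State (V × Bool)) : Prop where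
  rules_eq : s.rules = boundedRules Γ lt n
  treated_of_length_le : ∀ o : Overlap (V × Bool), o.IsIn s.rules → o.length ≤ n + 2 →
    o ∈ s.treated
  left_of_treated : ∀ o ∈ s.treated, o.left ∈ freeRules V ∨ o.left.1.length < n + 2

namespace RunInvariant

variable {n : ℕ} {s : State (V × Bool)}

omit [IsStrictTotalOrder (V × Bool) lt] in
theorem le_length_of_pending (h : RunInvariant Γ lt n s) {o : Overlap (V × Bool)}
    (ho : o ∈ s.pending) : n + 3 ≤ o.length := by
  by_contra hl
  exact ho.2 (h.treated_of_length_le o ho.1 (by omega))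

/-- The producing overlap has a normal left rule of length `n + 2`, which no treated overlap can
have. -/
theorem exists_pending (hnf : IsNormalizer lt nf) (h : RunInvariant Γ lt n s)
    {ρ : Rule (V × Bool)} (hρ : ρ ∈ normalRules Γ lt) (hl : ρ.1.length = n + 3) :
    ∃ o ∈ s.pending, o.length = n + 3 ∧ Produces lt nf s.rules o ρ := by
  obtain ⟨o, ho, hol, hleft, hll, hp⟩ := exists_overlap_produces hnf hρ hl
  refine ⟨o, ⟨h.rules_eq ▸ ho, fun ht => ?_⟩, hol, h.rules_eq ▸ hp⟩
  rcases h.left_of_treated o ht with h | h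
  · exact Set.disjoint_left.1 normalRules_disjoint_freeRules hleft h
  · omega

/-- The shortest pending overlaps may be longer than `n + 3`, but then they produce nothing: a
produced rule forces a long normal rule, its truncation to length `n + 3`, and so a pending overlap
of that length. -/
theorem length_of_produces (hlt : OrientsEdges Γ lt) (hnf : IsNormalizer lt nf)
    (h : RunInvariant Γ lt n s) {o : Overlap (V × Bool)} (ho : o ∈ s.next)
    {ρ : Rule (V × Bool)} (hρ : Produces lt nf s.rules o ρ) : o.length = n + 3 := by
  obtain ⟨ρ₁, hρ₁, hl₁⟩ :=
    exists_length_of_produces hlt hnf (h.rules_eq ▸ ho.1.1) (h.rules_eq ▸ hρ)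
  obtain ⟨ρ₂, hρ₂, hl₂⟩ := exists_mem_normalRules_of_length hρ₁ (by omega) hl₁
  obtain ⟨o', ho', hl', -⟩ := h.exists_pending hnf hρ₂ hl₂
  exact le_antisymm (hl' ▸ ho.2 o' ho') (h.le_length_of_pending ho.1)

theorem mem_of_produces (hlt : OrientsEdges Γ lt) (hnf : IsNormalizer lt nf)
    (h : RunInvariant Γ lt n s) {o : Overlap (V × Bool)} (ho : o ∈ s.next)
    {ρ : Rule (V × Bool)} (hρ : Produces lt nf s.rules o ρ) :
    o.left ∈ normalRules Γ lt ∧ o.right ∈ commRules Γ lt :=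
  RightAngledArtin.mem_of_produces hlt hnf (h.rules_eq ▸ ho.1.1)
    (h.length_of_produces hlt hnf ho hρ) (h.rules_eq ▸ hρ)

theorem newRules_eq (hlt : OrientsEdges Γ lt) (hnf : IsNormalizer lt nf)
    (h : RunInvariant Γ lt n s) :
    s.newRules lt nf = {ρ | ρ ∈ normalRules Γ lt ∧ ρ.1.length = n + 3} := by
  ext ρ
  constructor
  · rintro ⟨o, ho, hρ⟩
    exact mem_normalRules_of_produces hlt hnf (h.rules_eq ▸ ho.1.1)
      (h.length_of_produces hlt hnf ho hρ).le (h.rules_eq ▸ hρ)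
  · rintro ⟨hρ, hl⟩
    obtain ⟨o, ho, hol, hp⟩ := h.exists_pending hnf hρ hl
    exact ⟨o, ⟨ho, fun o' ho' => hol ▸ h.le_length_of_pending ho'⟩, hp⟩

theorem step (hlt : OrientsEdges Γ lt) (hnf : IsNormalizer lt nf) (h : RunInvariant Γ lt n s) :
    RunInvariant Γ lt (n + 1) (s.step lt nf) := by
  have hr : (s.step lt nf).rules = boundedRules Γ lt (n + 1) := by
    rw [State.step, h.newRules_eq hlt hnf, h.rules_eq, boundedRules, boundedRules,
      Set.union_right_comm]
    ext ρ
    simp only [Set.mem_union, Set.mem_ofPred_eq, ← and_or_left]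
    exact or_congr_left (and_congr_right fun _ => by omega)
  refine ⟨hr, fun o ho hl => ?_, ?_⟩
  · rw [hr] at ho
    have hlen := ho.length_lt
    have ho' := ho.mono (boundedRules_subset _)
    have hos : o.IsIn s.rules := by
      rw [h.rules_eq]
      exact ⟨ho.1, ho.2.1, ho.2.2.1, mem_boundedRules ho'.2.2.2.1 (by omega),
        mem_boundedRules ho'.2.2.2.2 (by omega)⟩
    by_cases ht : o ∈ s.treated
    · exact Or.inl ht
    · refine Or.inr ⟨⟨hos, ht⟩, fun o' ho' => ?_⟩
      have := h.le_length_of_pending ho'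
      omega
  · rintro o (ho | ho)
    · exact (h.left_of_treated o ho).imp_right fun h => by omega
    -- Rules present before the step have length at most `n + 2`, strictly below the new bound `(n +
    -- 1) + 2`.
    · have := length_le_of_mem_boundedRules (h.rules_eq ▸ ho.1.1.2.2.2.1)
      exact Or.inr (by omega)

end RunInvariant

theorem runInvariant_run (hlt : OrientsEdges Γ lt) (hnf : IsNormalizer lt nf) (n : ℕ) :
    RunInvariant Γ lt n (run lt nf (commRules Γ lt ∪ freeRules V) n) := by
  induction n with
  | zero =>
    refine ⟨boundedRules_zero.symm, fun o ho hl => ?_, fun _ h => h.elim⟩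
    have ho' : o.IsIn (boundedRules Γ lt 0) := boundedRules_zero (Γ := Γ) (lt := lt) ▸ ho
    have h₁ := two_le_length_of_mem (boundedRules_subset _ ho'.2.2.2.1)
    have h₂ := ho.length_lt
    omega
  | succ n ih => exact ih.step hlt hnf

theorem completion_eq (hlt : OrientsEdges Γ lt) (hnf : IsNormalizer lt nf) :
    completion lt nf (commRules Γ lt ∪ freeRules V) = normalRules Γ lt ∪ freeRules V := by
  ext ρ
  simp only [completion, Set.mem_iUnion, (runInvariant_run hlt hnf _).rules_eq]
  exact ⟨fun ⟨n, h⟩ => boundedRules_subset n h,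
    fun h => ⟨ρ.1.length, mem_boundedRules h (by omega)⟩⟩

theorem exists_mem_next (hlt : OrientsEdges Γ lt) (hnf : IsNormalizer lt nf)
    {o : Overlap (V × Bool)} (ho : o.IsIn (normalRules Γ lt ∪ freeRules V)) :
    ∃ n, o ∈ (run lt nf (commRules Γ lt ∪ freeRules V) n).next := by
  -- After `o.length` steps both rules are present and the overlap lies below the treated length.
  have h := runInvariant_run (nf := nf) hlt hnf o.length
  have hl := ho.length_lt
  refine exists_next_of_treated (h.treated_of_length_le o ?_ (by omega))
  rw [h.rules_eq]
  exact ⟨ho.1, ho.2.1, ho.2.2.1, mem_boundedRules ho.2.2.2.1 (by omega),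
    mem_boundedRules ho.2.2.2.2 (by omega)⟩

omit [IsStrictTotalOrder (V × Bool) lt] in
theorem positive_iff_of_mem_normalRules {ρ : Rule (V × Bool)} (h : ρ ∈ normalRules Γ lt) :
    Positive ρ.1 ↔ Positive ρ.2 :=
  forall_congr' fun _ => imp_congr_left (perm_of_mem_normalRules h).mem_iff

omit [IsStrictTotalOrder (V × Bool) lt] in
theorem not_positive_of_mem_freeRules {ρ : Rule (V × Bool)} (h : ρ ∈ freeRules V) :
    ¬ Positive ρ.1 := by
  obtain ⟨x, γ, rfl⟩ := h
  cases γ <;> simp [Positive]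

theorem exists_positive_normalRule (h : ∃ x y, Γ.Adj x y) :
    ∃ ρ ∈ normalRules Γ lt, Positive ρ.1 := by
  obtain ⟨x, y, h⟩ := h
  rcases lt_or_lt_of_adj (lt := lt) (a := (x, true)) (b := (y, true)) h with h' | h'
  · exact ⟨_, commRules_subset_normalRules (mem_commRules_iff.2 ⟨h.symm, h'⟩), by simp [Positive]⟩
  · exact ⟨_, commRules_subset_normalRules (mem_commRules_iff.2 ⟨h, h'⟩), by simp [Positive]⟩

end Completion

end RightAngledArtin

/-! ### The proposition -/

open KnuthBendix RightAngledArtin in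
theorem proposition4p6 {V : Type*} [Finite V] (Γ : SimpleGraph V)
    (lt : V × Bool → V × Bool → Prop) [IsStrictTotalOrder (V × Bool) lt]
    (hlt : OrientsEdges Γ lt)
    (nf : Set (Rule (V × Bool)) → List (V × Bool) → List (V × Bool))
    (hnf : IsNormalizer lt nf)
    (F R₀ R : Set (Rule (V × Bool))) (s : ℕ → State (V × Bool))
    (hF : F = freeRules V) (hR₀ : R₀ = commRules Γ lt)
    (hs : s = run lt nf (R₀ ∪ F)) (hR : R = completion lt nf (R₀ ∪ F) \ F) :
    -- the completed system is complete, equivalent to the initial one, and presents the group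
    (Complete (R ∪ F) ∧
      (∀ w w', Equivalent (R ∪ F) w w' ↔ Equivalent (R₀ ∪ F) w w') ∧
      (∀ w w', Equivalent (R ∪ F) w w' ↔ value Γ w = value Γ w')) ∧
    -- (A)
    (∀ ρ ∈ R, ∃ (u : List (V × Bool)) (x : V × Bool),
      ρ = (u ++ [x], x :: u) ∧ PrefixCondition R₀ u x) ∧
    -- (B)
    ((∀ o : Overlap (V × Bool), o.IsIn (R ∪ F) → ∃ n, o ∈ (s n).next) ∧
      (∀ n, ∀ o ∈ (s n).next, ∀ ρ, Produces lt nf (s n).rules o ρ →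
        o.left ∈ R ∧ o.right ∈ R₀) ∧
      (∀ n, ∀ o ∈ (s n).next, ¬ (o.left ∈ R ∧ o.right ∈ R₀) →
        o.Resolves (s n).rules)) ∧
    -- (C)
    ((∀ ρ ∈ R₀, ρ.1.length = 2 ∧ ρ.2.length = 2) ∧
      (∀ n, ∀ ρ ∈ (s n).newRules lt nf,
        ρ.1.length = (n + 1) + 2 ∧ ρ.2.length = (n + 1) + 2)) ∧
    -- (ii)
    ((∀ ρ ∈ R, Positive ρ.1 ↔ Positive ρ.2) ∧
      ((∃ x y, Γ.Adj x y) → ConditionCPlus R ∧ ConditionCPlus (R ∪ F))) := by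
  have hR' : R = normalRules Γ lt := by
    rw [hR, hR₀, hF, completion_eq hlt hnf, Set.union_sdiff_right,
      normalRules_disjoint_freeRules.sdiff_eq_left]
  have inv (n : ℕ) : RunInvariant Γ lt n (s n) := by
    rw [hs, hR₀, hF]
    exact runInvariant_run hlt hnf n
  have produces (n : ℕ) (o : Overlap (V × Bool)) (ho : o ∈ (s n).next) (ρ : Rule (V × Bool))
      (hρ : Produces lt nf (s n).rules o ρ) : o.left ∈ R ∧ o.right ∈ R₀ := by
    rw [hR', hR₀]
    exact (inv n).mem_of_produces hlt hnf ho hρ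
  refine ⟨⟨?_, ?_, ?_⟩, ?_, ⟨?_, produces, ?_⟩, ⟨?_, ?_⟩, ?_, ?_⟩
  · rw [hR', hF]
    exact complete_normalRules hlt
  · rw [hR', hR₀, hF]
    exact fun _ _ => equivalent_iff_equivalent
  · rw [hR', hF]
    exact fun _ _ => equivalent_iff_value_eq hlt
  · rw [hR', hR₀]
    rintro ρ ⟨u, x, hρ, hu, -⟩
    exact ⟨u, x, hρ, hu⟩
  · rw [hR', hs, hR₀, hF]
    exact fun _ => exists_mem_next hlt hnf
  · intro n o ho hno
    refine Overlap.resolves_of_nf_eq (nf := nf) (fun w => ?_) ?_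
    · rw [(inv n).rules_eq]
      exact (nf_boundedRules hnf n w).1
    -- Different normal forms would produce a rule, since shortlex is total, and then the overlap
    -- would be of the excluded kind.
    · by_contra hne
      obtain ⟨ρ, hρ⟩ := exists_produces_of_nf_ne (lt := lt) hne
      exact hno (produces n o ho ρ hρ)
  · rw [hR₀]
    rintro ρ ⟨x, y, γ, ε, -, -, rfl⟩
    simp
  · intro n ρ hρ
    rw [(inv n).newRules_eq hlt hnf] at hρ
    exact ⟨hρ.2, (perm_of_mem_normalRules hρ.1).length_eq.symm.trans hρ.2⟩
  · rw [hR']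
    exact fun _ => positive_iff_of_mem_normalRules
  · rw [hR', hF]
    intro h
    obtain ⟨ρ, hρ, hp⟩ := exists_positive_normalRule (lt := lt) h
    refine ⟨⟨⟨ρ, hρ, hp⟩, fun _ h h' => (positive_iff_of_mem_normalRules h).1 h'⟩,
      ⟨⟨ρ, Or.inl hρ, hp⟩, fun _ h h' => ?_⟩⟩
    rcases h with h | h
    · exact (positive_iff_of_mem_normalRules h).1 h'
    · exact (not_positive_of_mem_freeRules h h').elim
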